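/- Let $q\in\mathbb{C}$ with $|q|<1$. Write $(a;q)_\infty=\prod_{k\ge 0}(1-aq^k)$, $(a;q)_n=\prod_{k=0}^{n-1}(1-aq^k)$, and for integers $0<a<m$ $$J_m=(q^m;q^m)_\infty,\qquad J_{a,m}=(q^a;q^m)_\infty(q^{m-a};q^m)_\infty(q^m;q^m)_\infty .$$ Then the following twelve identities for triple sums over integers $i,j,k\ge 0$ hold, all the sums converging absolutely. (1) $$\sum_{i,j,k\ge 0}\frac{q^{i^2+3j^2+4k^2+2ij+4jk+i-2j}}{(q^2;q^2)_i(q^2;q^2)_j(q^4;q^4)_k}=\frac{J_4J_{14}J_{28}^2J_{2,28}}{J_2J_{1,28}J_{4,28}J_{8,28}J_{13,28}},$$ $$\sum_{i,j,k\ge 0}\frac{q^{i^2+3j^2+4k^2+2ij+4jk+i}}{(q^2;q^2)_i(q^2;q^2)_j(q^4;q^4)_k}=\frac{J_4J_{14}J_{28}^2J_{6,28}}{J_2J_{3,28}J_{4,28}J_{11,28}J_{12,28}},$$ $$\sum_{i,j,k\ge 0}\frac{q^{i^2+3j^2+4k^2+2ij+4jk+i+2j+4k}}{(q^2;q^2)_i(q^2;q^2)_j(q^4;q^4)_k}=\frac{J_4J_{14}J_{28}^2J_{10,28}}{J_2J_{5,28}J_{8,28}J_{9,28}J_{12,28}};$$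 (2) $$\sum_{i,j,k\ge 0}\frac{q^{i^2+4j^2+3k^2+2ij+4jk+i-2k}}{(q^2;q^2)_i(q^2;q^2)_j(q^4;q^4)_k}=\frac{J_4J_{14}J_{28}^2J_{2,28}}{J_2J_{1,28}J_{4,28}J_{8,28}J_{13,28}},$$ $$\sum_{i,j,k\ge 0}\frac{q^{i^2+4j^2+3k^2+2ij+4jk+i}}{(q^2;q^2)_i(q^2;q^2)_j(q^4;q^4)_k}=\frac{J_4J_{14}J_{28}^2J_{6,28}}{J_2J_{3,28}J_{4,28}J_{11,28}J_{12,28}},$$ $$\sum_{i,j,k\ge 0}\frac{q^{i^2+4j^2+3k^2+2ij+4jk+i+4j+2k}}{(q^2;q^2)_i(q^2;q^2)_j(q^4;q^4)_k}=\frac{J_4J_{14}J_{28}^2J_{10,28}}{J_2J_{5,28}J_{8,28}J_{9,28}J_{12,28}};$$ (3) $$\sum_{i,j,k\ge 0}\frac{q^{3i^2+6j^2+16k^2+4ij+8ik+16jk-2i-2j}}{(q^4;q^4)_i(q^4;q^4)_j(q^8;q^8)_k}=\frac{J_{14}J_{28}^2J_{2,28}}{J_{1,28}J_{4,28}J_{8,28}J_{13,28}},$$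 $$\sum_{i,j,k\ge 0}\frac{q^{3i^2+6j^2+16k^2+4ij+8ik+16jk-2j}}{(q^4;q^4)_i(q^4;q^4)_j(q^8;q^8)_k}=\frac{J_{14}J_{28}^2J_{6,28}}{J_{3,28}J_{4,28}J_{11,28}J_{12,28}},$$ $$\sum_{i,j,k\ge 0}\frac{q^{3i^2+6j^2+16k^2+4ij+8ik+16jk+2i+2j+8k}}{(q^4;q^4)_i(q^4;q^4)_j(q^8;q^8)_k}=\frac{J_{14}J_{28}^2J_{10,28}}{J_{5,28}J_{8,28}J_{9,28}J_{12,28}};$$ (4) $$\sum_{i,j,k\ge 0}\frac{q^{4i^2+5j^2+12k^2+4ij+8ik+12jk-4j-4k}}{(q^4;q^4)_i(q^4;q^4)_j(q^8;q^8)_k}=\frac{J_{14}J_{28}^2J_{2,28}}{J_{1,28}J_{4,28}J_{8,28}J_{13,28}},$$ $$\sum_{i,j,k\ge 0}\frac{q^{4i^2+5j^2+12k^2+4ij+8ik+12jk-2j}}{(q^4;q^4)_i(q^4;q^4)_j(q^8;q^8)_k}=\frac{J_{14}J_{28}^2J_{6,28}}{J_{3,28}J_{4,28}J_{11,28}J_{12,28}},$$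 $$\sum_{i,j,k\ge 0}\frac{q^{4i^2+5j^2+12k^2+4ij+8ik+12jk+4i+4k}}{(q^4;q^4)_i(q^4;q^4)_j(q^8;q^8)_k}=\frac{J_{14}J_{28}^2J_{10,28}}{J_{5,28}J_{8,28}J_{9,28}J_{12,28}}.$$ -/

import Mathlib

/-- The finite `q`-shifted factorial `(a; q)_n = ∏_{k=0}^{n-1} (1 - a q^k)`. -/
noncomputable def qPoch (a q : ℂ) (n : ℕ) : ℂ :=
  ∏ k ∈ Finset.range n, (1 - a * q ^ k)

/-- The infinite `q`-shifted factorial `(a; q)_∞ = ∏_{k=0}^∞ (1 - a q^k)`, for `|q| < 1`. -/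
noncomputable def qPochInf (a q : ℂ) : ℂ :=
  ∏' k : ℕ, (1 - a * q ^ k)

/-- The product defining `(a; q)_∞` converges (absolutely) for `|q| < 1`. -/
theorem multipliable_qPochInf (a : ℂ) {q : ℂ} (hq : ‖q‖ < 1) :
    Multipliable fun k : ℕ => 1 - a * q ^ k := by
  have h : Summable fun k : ℕ => ‖-(a * q ^ k)‖ := by
    simpa [norm_mul, norm_pow] using
      (summable_geometric_of_lt_one (norm_nonneg q) hq).mul_left ‖a‖
  simpa [sub_eq_add_neg] using multipliable_one_add_of_summable h

/-- `J_m = (q^m; q^m)_∞`. -/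
noncomputable def J (q : ℂ) (m : ℕ) : ℂ :=
  qPochInf (q ^ m) (q ^ m)

/-- `J_{a,m} = (q^a, q^{m-a}, q^m; q^m)_∞`, used for `0 < a < m`. -/
noncomputable def Jtheta (q : ℂ) (a m : ℕ) : ℂ :=
  qPochInf (q ^ a) (q ^ m) * qPochInf (q ^ (m - a)) (q ^ m) * qPochInf (q ^ m) (q ^ m)

/-- `q^{Q(i,j,k)} / ((q^r; q^r)_i (q^r; q^r)_j (q^{2r}; q^{2r})_k)`: the `(i, j, k)` term of a
triple sum of index `(1,1,2)` in base `q^r`, with integer-valued exponent `Q`. -/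
noncomputable def nahmTerm (q : ℂ) (r : ℕ) (Q : ℤ → ℤ → ℤ → ℤ) (n : ℕ × ℕ × ℕ) : ℂ :=
  q ^ Q n.1 n.2.1 n.2.2 /
    (qPoch (q ^ r) (q ^ r) n.1 * qPoch (q ^ r) (q ^ r) n.2.1 *
      qPoch (q ^ (2 * r)) (q ^ (2 * r)) n.2.2)

/-!
The finite products obey Euler's expansions of `(x; p)_∞` and `1 / (x; p)_∞`, which evaluate one
index of each triple sum: in base `q²` the sum over `i` is an infinite product, and in base `q⁴`
the identity `(-x; p)_∞ / (x²; p²)_∞ = 1 / (x; p)_∞` merges the indices `j` and `k`. All twelve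
triple sums thus become three double sums, up to the factor `J_4 / J_2`. A second use of Euler's
expansions turns these double sums into single sums of Slater type, which the Bailey transform,
fed with finite forms of theta function identities (sums `∑_j p^{6j²+bj} [N; k + 3j]_p`), evaluates
as differences of two theta series. The quintuple product identity writes each such difference as
an infinite product.
-/

open Filter Topology Finset

section qPoch

theorem qPoch_zero (a p : ℂ) : qPoch a p 0 = 1 := by simp [qPoch]

theorem qPoch_succ (a p : ℂ) (n : ℕ) : qPoch a p (n + 1) = qPoch a p n * (1 - a * p ^ n) := by
  simp [qPoch, prod_range_succ]

theorem qPoch_add (a p : ℂ) (m n : ℕ) :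
    qPoch a p (m + n) = qPoch a p m * qPoch (a * p ^ m) p n := by
  simp [qPoch, prod_range_add, pow_add, mul_assoc]

theorem qPoch_sq (a p : ℂ) (n : ℕ) : qPoch (a ^ 2) (p ^ 2) n = qPoch a p n * qPoch (-a) p n := by
  simp only [qPoch, ← prod_mul_distrib]
  exact prod_congr rfl fun k _ => by ring

theorem mul_pow_ne_one {a p : ℂ} (ha : ‖a‖ < 1) (hp : ‖p‖ ≤ 1) (k : ℕ) : a * p ^ k ≠ 1 := by
  refine fun h => (mul_lt_one_of_nonneg_of_lt_one_left (norm_nonneg a) ha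
    (pow_le_one₀ (n := k) (norm_nonneg p) hp)).ne ?_
  rw [← norm_pow, ← norm_mul, h, norm_one]

theorem one_sub_mul_pow_ne_zero {a p : ℂ} (ha : ‖a‖ < 1) (hp : ‖p‖ ≤ 1) (k : ℕ) :
    1 - a * p ^ k ≠ 0 :=
  sub_ne_zero.2 (mul_pow_ne_one ha hp k).symm

theorem qPoch_ne_zero {a p : ℂ} (ha : ‖a‖ < 1) (hp : ‖p‖ ≤ 1) (n : ℕ) : qPoch a p n ≠ 0 :=
  prod_ne_zero_iff.2 fun k _ => one_sub_mul_pow_ne_zero ha hp k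

theorem norm_pow_lt_one {q : ℂ} (hq : ‖q‖ < 1) {n : ℕ} (hn : n ≠ 0) : ‖q ^ n‖ < 1 := by
  rw [norm_pow]
  exact pow_lt_one₀ (norm_nonneg q) hq hn

variable {p : ℂ} (hp : ‖p‖ < 1)
include hp

theorem tendsto_qPoch (a : ℂ) : Tendsto (qPoch a p) atTop (𝓝 (qPochInf a p)) :=
  (multipliable_qPochInf a hp).tendsto_prod_tprod_nat

theorem qPochInf_eq_mul (a : ℂ) (n : ℕ) :
    qPochInf a p = qPoch a p n * qPochInf (a * p ^ n) p := by
  have hshift := ((tendsto_qPoch hp (a * p ^ n)).const_mul (qPoch a p n)).congr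
    fun N => (qPoch_add a p n N).symm
  refine tendsto_nhds_unique ((tendsto_qPoch hp a).comp (tendsto_add_atTop_nat n)) (hshift.congr ?_)
  simp [add_comm n]

theorem qPochInf_ne_zero {a : ℂ} (ha : ‖a‖ < 1) : qPochInf a p ≠ 0 := by
  have hs : Summable fun k : ℕ => ‖-(a * p ^ k)‖ := by
    simpa only [norm_neg, norm_mul, norm_pow] using
      (summable_geometric_of_lt_one (norm_nonneg p) hp).mul_left ‖a‖
  simpa only [qPochInf, sub_eq_add_neg] using tprod_one_add_ne_zero_of_summable
    (fun k => by simpa only [← sub_eq_add_neg] using one_sub_mul_pow_ne_zero ha hp.le k) hs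

theorem exists_norm_qPoch_le (a : ℂ) : ∃ C, ∀ n, ‖qPoch a p n‖ ≤ C := by
  obtain ⟨C, hC⟩ := (Metric.isBounded_range_of_tendsto _ (tendsto_qPoch hp a)).exists_norm_le
  exact ⟨C, fun n => hC _ ⟨n, rfl⟩⟩

theorem exists_norm_inv_qPoch_le {a : ℂ} (ha : ‖a‖ < 1) : ∃ C, ∀ n, ‖(qPoch a p n)⁻¹‖ ≤ C := by
  obtain ⟨C, hC⟩ := (Metric.isBounded_range_of_tendsto _
    ((tendsto_qPoch hp a).inv₀ (qPochInf_ne_zero hp ha))).exists_norm_le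
  exact ⟨C, fun n => hC _ ⟨n, rfl⟩⟩

theorem qPochInf_eq_prod (a : ℂ) {n : ℕ} (hn : n ≠ 0) :
    qPochInf a p = ∏ i ∈ range n, qPochInf (a * p ^ i) (p ^ n) := by
  have h1 : Tendsto (fun N => qPoch a p (n * N)) atTop (𝓝 (qPochInf a p)) :=
    (tendsto_qPoch hp a).comp (tendsto_id.const_mul_atTop' (Nat.pos_of_ne_zero hn))
  have h2 : Tendsto (fun N => ∏ i ∈ range n, qPoch (a * p ^ i) (p ^ n) N) atTop
      (𝓝 (∏ i ∈ range n, qPochInf (a * p ^ i) (p ^ n))) :=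
    tendsto_finsetProd _ fun i _ => tendsto_qPoch (norm_pow_lt_one hp hn) _
  refine tendsto_nhds_unique h1 (h2.congr fun N => ?_)
  induction N with
  | zero => simp [qPoch_zero]
  | succ N ih =>
    simp_rw [qPoch_succ, prod_mul_distrib, ih]
    rw [Nat.mul_succ, qPoch_add]
    congr 1
    exact prod_congr rfl fun i _ => by rw [← pow_mul]; ring

theorem qPochInf_sq (a : ℂ) : qPochInf (a ^ 2) (p ^ 2) = qPochInf a p * qPochInf (-a) p :=
  tendsto_nhds_unique (tendsto_qPoch (norm_pow_lt_one hp two_ne_zero) _)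
    (((tendsto_qPoch hp a).mul (tendsto_qPoch hp (-a))).congr fun n => (qPoch_sq a p n).symm)

end qPoch

section summability

theorem two_mul_choose_two_add (n : ℕ) : 2 * n.choose 2 + n = n ^ 2 := by
  induction n with
  | zero => rfl
  | succ n ih => rw [Nat.choose_succ_succ', Nat.choose_one_right]; linarith

theorem choose_two_succ (n : ℕ) : (n + 1).choose 2 = n.choose 2 + n := by
  rw [Nat.choose_succ_succ', Nat.choose_one_right, add_comm]

theorem summable_norm_pow_choose_two_mul_pow {p : ℂ} (hp : ‖p‖ < 1) (y : ℂ) :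
    Summable fun n : ℕ => ‖p ^ n.choose 2 * y ^ n‖ := by
  have hlim : Tendsto (fun n => ‖p‖ ^ n * ‖y‖) atTop (𝓝 0) := by
    simpa using (tendsto_pow_atTop_nhds_zero_of_lt_one (norm_nonneg p) hp).mul_const ‖y‖
  refine summable_of_ratio_norm_eventually_le (r := 1 / 2) (by norm_num) ?_
  filter_upwards [hlim.eventually (eventually_le_nhds one_half_pos)] with n hn
  calc ‖‖p ^ (n + 1).choose 2 * y ^ (n + 1)‖‖
      = ‖p‖ ^ n * ‖y‖ * ‖‖p ^ n.choose 2 * y ^ n‖‖ := by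
        simp only [choose_two_succ, norm_mul, norm_pow, norm_norm]
        ring
    _ ≤ 1 / 2 * ‖‖p ^ n.choose 2 * y ^ n‖‖ := by gcongr

theorem summable_norm_zpow_mul_zpow_sq {t : ℂ} (ht : ‖t‖ < 1) (x : ℂ) :
    Summable fun k : ℤ => ‖x ^ k * t ^ k ^ 2‖ := by
  have hnat : ∀ x : ℂ, Summable fun n : ℕ => ‖x ^ (n : ℤ) * t ^ (n : ℤ) ^ 2‖ := fun x => by
    refine (summable_norm_pow_choose_two_mul_pow (norm_pow_lt_one ht two_ne_zero) (x * t)).congr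
      fun n => ?_
    rw [← Nat.cast_pow, zpow_natCast, zpow_natCast, ← two_mul_choose_two_add]
    ring_nf
  exact .of_nat_of_neg (hnat x) (by simpa [zpow_neg] using hnat x⁻¹)

end summability

section euler

variable {p : ℂ} (hp : ‖p‖ < 1)
include hp

theorem summable_norm_euler (y : ℂ) :
    Summable fun n : ℕ => ‖p ^ n.choose 2 * (-y) ^ n / qPoch p p n‖ := by
  obtain ⟨C, hC⟩ := exists_norm_inv_qPoch_le hp hp
  refine ((summable_norm_pow_choose_two_mul_pow hp (-y)).mul_right C).of_nonneg_of_le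
    (fun _ => norm_nonneg _) fun n => ?_
  rw [div_eq_mul_inv, norm_mul]
  exact mul_le_mul_of_nonneg_left (hC n) (norm_nonneg _)

theorem tsum_euler_eq_one_sub_mul (y : ℂ) :
    ∑' n : ℕ, p ^ n.choose 2 * (-y) ^ n / qPoch p p n =
      (1 - y) * ∑' n : ℕ, p ^ n.choose 2 * (-(y * p)) ^ n / qPoch p p n := by
  have hsum := fun y => (summable_norm_euler hp y).of_norm
  suffices h : (∑' n : ℕ, p ^ n.choose 2 * (-y) ^ n / qPoch p p n) -
      ∑' n : ℕ, p ^ n.choose 2 * (-(y * p)) ^ n / qPoch p p n =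
      -y * ∑' n : ℕ, p ^ n.choose 2 * (-(y * p)) ^ n / qPoch p p n by linear_combination h
  rw [← (hsum y).tsum_sub (hsum _), ((hsum y).sub (hsum _)).tsum_eq_zero_add, ← tsum_mul_left]
  simp only [pow_zero, sub_self, zero_add]
  refine tsum_congr fun n => ?_
  have hn := qPoch_ne_zero hp hp.le n
  have hn1 := one_sub_mul_pow_ne_zero hp hp.le n
  rw [qPoch_succ, choose_two_succ, pow_add, ← pow_succ']
  rw [← pow_succ'] at hn1
  field_simp
  ring

theorem tendsto_tsum_euler (y : ℂ) :
    Tendsto (fun N : ℕ => ∑' n : ℕ, p ^ n.choose 2 * (-(y * p ^ N)) ^ n / qPoch p p n)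
      atTop (𝓝 1) := by
  have hval : ∑' n : ℕ, (if n = 0 then (1 : ℂ) else 0) = 1 := by simp
  rw [← hval]
  refine tendsto_tsum_of_dominated_convergence (summable_norm_euler hp y) (fun n => ?_)
    (.of_forall fun N n => ?_)
  · rcases eq_or_ne n 0 with rfl | hn
    · simp [qPoch_zero]
    · have h0 : Tendsto (fun N : ℕ => -(y * p ^ N)) atTop (𝓝 0) := by
        simpa using ((tendsto_pow_atTop_nhds_zero_of_norm_lt_one hp).const_mul y).neg
      simpa [hn] using ((h0.pow n).const_mul (p ^ n.choose 2)).div_const (qPoch p p n)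
  · simp only [norm_div, norm_mul, norm_pow, norm_neg]
    gcongr
    exact mul_le_of_le_one_right (norm_nonneg y) (pow_le_one₀ (norm_nonneg p) hp.le)

theorem hasSum_euler (y : ℂ) :
    HasSum (fun n : ℕ => p ^ n.choose 2 * (-y) ^ n / qPoch p p n) (qPochInf y p) := by
  have hiter : ∀ N, ∑' n : ℕ, p ^ n.choose 2 * (-y) ^ n / qPoch p p n =
      qPoch y p N * ∑' n : ℕ, p ^ n.choose 2 * (-(y * p ^ N)) ^ n / qPoch p p n := fun N => by
    induction N with
    | zero => simp [qPoch_zero]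
    | succ N ih =>
      rw [ih, tsum_euler_eq_one_sub_mul hp, qPoch_succ, pow_succ, mul_assoc, mul_assoc]
  have hlim := ((tendsto_qPoch hp y).mul (tendsto_tsum_euler hp y)).congr
    fun N => (hiter N).symm
  rw [mul_one] at hlim
  exact tendsto_nhds_unique hlim tendsto_const_nhds ▸ (summable_norm_euler hp y).of_norm.hasSum

end euler

section powerSeries

open PowerSeries

theorem eq_of_rescale_eq_mul {R : Type*} [CommRing R] [IsDomain R] {F G U : PowerSeries R} {r : R}
    (hr : ∀ n : ℕ, r ^ (n + 1) ≠ 1) (hU : constantCoeff U = 1) (hF : rescale r F = U * F)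
    (hG : rescale r G = U * G) (h0 : constantCoeff F = constantCoeff G) : F = G := by
  have hD : rescale r (F - G) = U * (F - G) := by rw [map_sub, hF, hG, mul_sub]
  refine sub_eq_zero.1 (PowerSeries.ext fun n => ?_)
  rw [map_zero]
  induction n using Nat.strong_induction_on with
  | _ n ih =>
    cases n with
    | zero => rw [coeff_zero_eq_constantCoeff, map_sub, h0, sub_self]
    | succ n =>
      have hcoeff := congrArg (coeff (n + 1)) hD
      rw [coeff_rescale, coeff_mul, Nat.sum_antidiagonal_succ, coeff_zero_eq_constantCoeff, hU,
        sum_eq_zero fun x hx => by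
          rw [ih x.2 (by have := mem_antidiagonal.1 hx; lia), mul_zero]] at hcoeff
      refine (mul_eq_zero.1 ?_).resolve_left (sub_ne_zero.2 (hr n))
      linear_combination hcoeff

theorem rescale_expand {R : Type*} [CommRing R] (r : R) {k : ℕ} (hk : k ≠ 0) (F : PowerSeries R) :
    rescale r (expand k hk F) = expand k hk (rescale (r ^ k) F) := by
  ext n
  simp only [coeff_rescale, coeff_expand]
  split_ifs with h
  · rw [← pow_mul, Nat.mul_div_cancel' h]
  · rw [mul_zero]

/-- The expansion of `1 / (X; p)_∞`. -/
noncomputable def eulerSeries (p : ℂ) : PowerSeries ℂ :=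
  mk fun n => (qPoch p p n)⁻¹

/-- The expansion of `(-X; p)_∞`. -/
noncomputable def dualEulerSeries (p : ℂ) : PowerSeries ℂ :=
  mk fun n => p ^ n.choose 2 / qPoch p p n

/-- The expansion of `1 / (X²; p²)_∞`. -/
noncomputable def evenEulerSeries (p : ℂ) : PowerSeries ℂ :=
  expand 2 two_ne_zero (eulerSeries (p ^ 2))

theorem constantCoeff_eulerSeries (p : ℂ) : constantCoeff (eulerSeries p) = 1 := by
  simp [eulerSeries, qPoch_zero]

theorem constantCoeff_dualEulerSeries (p : ℂ) : constantCoeff (dualEulerSeries p) = 1 := by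
  simp [dualEulerSeries, qPoch_zero]

theorem constantCoeff_rescale {R : Type*} [CommRing R] (r : R) (F : PowerSeries R) :
    constantCoeff (rescale r F) = constantCoeff F := by
  rw [← coeff_zero_eq_constantCoeff, coeff_rescale, pow_zero, one_mul]

variable {p : ℂ} (hp : ‖p‖ < 1)
include hp

theorem pow_succ_ne_one (n : ℕ) : p ^ (n + 1) ≠ 1 := by
  rw [pow_succ']
  exact mul_pow_ne_one hp hp.le n

theorem one_sub_pow_succ_mul_inv_qPoch (n : ℕ) :
    (1 - p ^ (n + 1)) * (qPoch p p (n + 1))⁻¹ = (qPoch p p n)⁻¹ := by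
  rw [qPoch_succ, mul_inv, ← pow_succ', mul_comm,
    inv_mul_cancel_right₀ (sub_ne_zero.2 (pow_succ_ne_one hp n).symm)]

theorem rescale_eulerSeries : rescale p (eulerSeries p) = (1 - X) * eulerSeries p := by
  ext n
  rw [coeff_rescale, sub_mul, one_mul, map_sub]
  cases n with
  | zero => simp
  | succ n =>
    rw [coeff_succ_X_mul, eulerSeries, coeff_mk, coeff_mk, ← one_sub_pow_succ_mul_inv_qPoch hp n]
    ring

theorem rescale_rescale_eulerSeries (c : ℂ) :
    rescale p (rescale c (eulerSeries p)) = (1 - C c * X) * rescale c (eulerSeries p) := by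
  rw [rescale_rescale, mul_comm, ← rescale_rescale, rescale_eulerSeries hp, map_mul, map_sub,
    map_one, rescale_X]

theorem one_add_X_mul_rescale_dualEulerSeries :
    (1 + X) * rescale p (dualEulerSeries p) = dualEulerSeries p := by
  ext n
  rw [add_mul, one_mul, map_add]
  cases n with
  | zero => simp
  | succ n =>
    rw [coeff_succ_X_mul, coeff_rescale, coeff_rescale, dualEulerSeries, coeff_mk, coeff_mk,
      div_eq_mul_inv, div_eq_mul_inv, ← one_sub_pow_succ_mul_inv_qPoch hp n, choose_two_succ]
    ring

theorem rescale_evenEulerSeries :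
    rescale p (evenEulerSeries p) = (1 - X ^ 2) * evenEulerSeries p := by
  rw [evenEulerSeries, rescale_expand, rescale_eulerSeries (norm_pow_lt_one hp two_ne_zero),
    map_mul, map_sub, map_one, expand_X]

theorem dualEulerSeries_mul_rescale_eulerSeries :
    dualEulerSeries p * rescale (-1) (eulerSeries p) = 1 := by
  refine eq_of_rescale_eq_mul (U := 1) (pow_succ_ne_one hp) (map_one _) ?_ (by simp) (by
    simp [constantCoeff_rescale, constantCoeff_eulerSeries, constantCoeff_dualEulerSeries])
  rw [map_mul, rescale_rescale_eulerSeries hp, one_mul, map_neg, map_one]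
  linear_combination
    rescale (-1) (eulerSeries p) * one_add_X_mul_rescale_dualEulerSeries hp

theorem evenEulerSeries_eq_mul :
    evenEulerSeries p = eulerSeries p * rescale (-1) (eulerSeries p) := by
  refine eq_of_rescale_eq_mul (pow_succ_ne_one hp) (by simp) (rescale_evenEulerSeries hp) ?_
    (by simp [constantCoeff_rescale, constantCoeff_eulerSeries, evenEulerSeries])
  rw [map_mul, rescale_eulerSeries hp, rescale_rescale_eulerSeries hp, map_neg, map_one]
  ring

theorem eulerSeries_eq_mul :
    eulerSeries p = eulerSeries (p ^ 2) * rescale p (eulerSeries (p ^ 2)) := by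
  have hp2 := norm_pow_lt_one hp two_ne_zero
  refine eq_of_rescale_eq_mul (r := p ^ 2) (U := (1 - C p * X) * (1 - X)) (pow_succ_ne_one hp2)
    (by simp) ?_ ?_ (by simp [constantCoeff_rescale, constantCoeff_eulerSeries])
  · rw [sq, ← rescale_rescale, rescale_eulerSeries hp, map_mul, map_sub, map_one, rescale_X,
      rescale_eulerSeries hp, mul_assoc]
  · rw [map_mul, rescale_eulerSeries hp2, rescale_rescale_eulerSeries hp2]
    ring

theorem dualEulerSeries_mul_evenEulerSeries :
    dualEulerSeries p * evenEulerSeries p = eulerSeries p := by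
  rw [evenEulerSeries_eq_mul hp, mul_left_comm, dualEulerSeries_mul_rescale_eulerSeries hp, mul_one]

theorem evenEulerSeries_eq_mul_mul : evenEulerSeries p =
    eulerSeries p * (rescale (-1) (eulerSeries (p ^ 2)) * rescale (-p) (eulerSeries (p ^ 2))) := by
  have h := congrArg (rescale (-1)) (eulerSeries_eq_mul hp)
  rw [map_mul, rescale_rescale, mul_neg_one] at h
  rw [evenEulerSeries_eq_mul hp, h]

theorem dualEulerSeries_sq_mul_evenEulerSeries :
    dualEulerSeries (p ^ 2) * evenEulerSeries p =
      eulerSeries p * rescale (-p) (eulerSeries (p ^ 2)) := by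
  rw [evenEulerSeries_eq_mul_mul hp]
  linear_combination (eulerSeries p * rescale (-p) (eulerSeries (p ^ 2))) *
    dualEulerSeries_mul_rescale_eulerSeries (norm_pow_lt_one hp two_ne_zero)

theorem rescale_dualEulerSeries_sq_mul_evenEulerSeries :
    rescale p (dualEulerSeries (p ^ 2)) * evenEulerSeries p =
      eulerSeries p * rescale (-1) (eulerSeries (p ^ 2)) := by
  have h := congrArg (rescale p)
    (dualEulerSeries_mul_rescale_eulerSeries (norm_pow_lt_one hp two_ne_zero))
  rw [map_mul, map_one, rescale_rescale, neg_one_mul] at h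
  rw [evenEulerSeries_eq_mul_mul hp]
  linear_combination (eulerSeries p * rescale (-1) (eulerSeries (p ^ 2))) * h

theorem sum_antidiagonal_qPoch_mul_pow (a : ℂ) (N : ℕ) :
    ∑ x ∈ antidiagonal N, qPoch a p x.1 / qPoch p p x.1 * (a ^ x.2 / qPoch p p x.2) =
      (qPoch p p N)⁻¹ := by
  set F : PowerSeries ℂ := mk fun n => qPoch a p n / qPoch p p n with hF_def
  have hF : (1 - C a * X) * rescale p F = (1 - X) * F := by
    ext n
    simp only [sub_mul, one_mul, map_sub, mul_assoc, coeff_C_mul]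
    cases n with
    | zero => simp
    | succ n =>
      simp only [hF_def, coeff_succ_X_mul, coeff_rescale, coeff_mk, div_eq_mul_inv,
        ← one_sub_pow_succ_mul_inv_qPoch hp n, qPoch_succ a]
      ring
  have hprod : F * rescale a (eulerSeries p) = eulerSeries p := by
    refine eq_of_rescale_eq_mul (pow_succ_ne_one hp) (by simp) ?_ (rescale_eulerSeries hp)
      (by simp [hF_def, constantCoeff_rescale, constantCoeff_eulerSeries, qPoch_zero])
    rw [map_mul, rescale_rescale_eulerSeries hp]
    linear_combination rescale a (eulerSeries p) * hF
  simpa only [coeff_mul, hF_def, eulerSeries, coeff_rescale, coeff_mk, ← div_eq_mul_inv] using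
    congrArg (coeff N) hprod

end powerSeries

section bailey

theorem hasSum_antidiagonal {α : Type*} [AddCommMonoid α] [TopologicalSpace α] [RegularSpace α]
    [ContinuousAdd α] {f : ℕ × ℕ → α} {a : α} (h : HasSum f a) :
    HasSum (fun n => ∑ x ∈ antidiagonal n, f x) a := by
  refine (HasAntidiagonal.sigmaAntidiagonalEquivProd.hasSum_iff.2 h).sigma fun n => ?_
  rw [← sum_coe_sort]
  exact hasSum_fintype _

theorem add_choose_two (m n : ℕ) : (m + n).choose 2 = m.choose 2 + n.choose 2 + m * n := by
  induction n with
  | zero => simp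
  | succ n ih => rw [← add_assoc, choose_two_succ, choose_two_succ, ih]; ring

/-- `1 / (p; p)_k` for an integer `k`, with value `0` for negative `k`. -/
noncomputable def invQPoch (p : ℂ) (k : ℤ) : ℂ :=
  if k < 0 then 0 else (qPoch p p k.toNat)⁻¹

theorem invQPoch_natCast (p : ℂ) (n : ℕ) : invQPoch p n = (qPoch p p n)⁻¹ := by
  simp [invQPoch]

theorem invQPoch_of_neg (p : ℂ) {k : ℤ} (hk : k < 0) : invQPoch p k = 0 := if_pos hk

theorem exists_norm_invQPoch_le {p : ℂ} (hp : ‖p‖ < 1) : ∃ C, ∀ k, ‖invQPoch p k‖ ≤ C := by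
  obtain ⟨C, hC⟩ := exists_norm_inv_qPoch_le hp hp
  refine ⟨C, fun k => ?_⟩
  rw [invQPoch]
  split_ifs
  · exact norm_zero.trans_le ((norm_nonneg _).trans (hC 0))
  · exact hC _

theorem summable_one_phi_one {p : ℂ} (hp : ‖p‖ < 1) (a x : ℂ) :
    Summable fun y : ℕ × ℕ => qPoch a p y.1 * (p ^ y.1.choose 2 * (-x) ^ y.1 / qPoch p p y.1) *
      (p ^ y.2.choose 2 * (-(a * x * p ^ y.1)) ^ y.2 / qPoch p p y.2) := by
  obtain ⟨C, hC⟩ := exists_norm_qPoch_le hp a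
  refine .of_norm_bounded (((summable_norm_euler hp x).mul_of_nonneg
    (summable_norm_euler hp (a * x)) (fun _ => norm_nonneg _)
    fun _ => norm_nonneg _).mul_left C) fun y => ?_
  rw [norm_mul, norm_mul, ← mul_assoc]
  gcongr ?_ * _ * ?_
  · exact mul_nonneg ((norm_nonneg _).trans (hC 0)) (norm_nonneg _)
  · exact hC _
  · simp only [norm_div, norm_mul, norm_pow, norm_neg]
    gcongr ‖p‖ ^ _ * ?_ ^ _ / _
    exact mul_le_of_le_one_right (by positivity) (pow_le_one₀ (norm_nonneg p) hp.le)

theorem hasSum_one_phi_one {p : ℂ} (hp : ‖p‖ < 1) (a x : ℂ) :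
    HasSum (fun m : ℕ => qPoch a p m * (p ^ m.choose 2 * (-x) ^ m / qPoch p p m) *
      qPochInf (a * x * p ^ m) p) (qPochInf x p) := by
  have hanti (n : ℕ) : ∑ y ∈ antidiagonal n,
      qPoch a p y.1 * (p ^ y.1.choose 2 * (-x) ^ y.1 / qPoch p p y.1) *
        (p ^ y.2.choose 2 * (-(a * x * p ^ y.1)) ^ y.2 / qPoch p p y.2) =
      p ^ n.choose 2 * (-x) ^ n / qPoch p p n := by
    rw [div_eq_mul_inv _ (qPoch p p n), ← sum_antidiagonal_qPoch_mul_pow hp a n, mul_sum]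
    refine sum_congr rfl fun y hy => ?_
    rw [← mem_antidiagonal.1 hy, add_choose_two]
    ring
  have hsum := (summable_one_phi_one hp a x).hasSum
  have hval := (hasSum_antidiagonal hsum).unique (funext hanti ▸ hasSum_euler hp x)
  have hfiber (m : ℕ) := (hasSum_euler hp (a * x * p ^ m)).mul_left
    (qPoch a p m * (p ^ m.choose 2 * (-x) ^ m / qPoch p p m))
  exact hval ▸ hsum.prod_fiberwise hfiber

theorem hasSum_bailey_natCast {s : ℂ} (hs : ‖s‖ < 1) (k : ℕ) :
    HasSum (fun m : ℕ => s ^ m ^ 2 * qPoch (-s) (s ^ 2) m *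
      (invQPoch (s ^ 2) (m - k) * invQPoch (s ^ 2) (m + k)))
      (s ^ k ^ 2 * (qPochInf (-s) (s ^ 2) / qPochInf (s ^ 2) (s ^ 2))) := by
  have hp := norm_pow_lt_one hs two_ne_zero
  set x := -s ^ (1 + 2 * k) with hx
  have hshift : -s * (s ^ 2) ^ k = x := by rw [hx]; ring
  rw [← (add_left_injective k).hasSum_iff]
  · convert! (hasSum_one_phi_one hp x x).mul_left
      (s ^ k ^ 2 * qPoch (-s) (s ^ 2) k / qPochInf (s ^ 2) (s ^ 2)) using 1
    · funext r
      have hinf : qPochInf (s ^ 2) (s ^ 2) =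
          qPoch (s ^ 2) (s ^ 2) (r + 2 * k) * qPochInf (x * x * (s ^ 2) ^ r) (s ^ 2) := by
        rw [qPochInf_eq_mul hp _ (r + 2 * k), hx]
        ring_nf
      have hne := right_ne_zero_of_mul (hinf ▸ qPochInf_ne_zero hp hp)
      have hexp : s ^ (r + k) ^ 2 = s ^ k ^ 2 * ((s ^ 2) ^ r.choose 2 * (s ^ (1 + 2 * k)) ^ r) := by
        rw [add_sq, ← two_mul_choose_two_add r]
        ring
      have := qPoch_ne_zero hp hp.le r
      simp only [Function.comp_apply, Nat.cast_add, add_sub_cancel_right]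
      rw [show (r : ℤ) + k + k = (r + 2 * k : ℕ) by push_cast; ring, invQPoch_natCast,
        invQPoch_natCast, hinf, add_comm r k, qPoch_add, hshift, add_comm k r, hexp]
      generalize qPochInf (x * x * (s ^ 2) ^ r) (s ^ 2) = Y at hne ⊢
      rw [hx, neg_neg]
      field_simp
    · rw [qPochInf_eq_mul hp (-s) k, hshift]
      ring
  · intro m hm
    have hmk : m < k := not_le.1 fun h => hm ⟨m - k, Nat.sub_add_cancel h⟩
    rw [invQPoch_of_neg _ (by lia : (m : ℤ) - k < 0), zero_mul, mul_zero]

theorem hasSum_bailey {s : ℂ} (hs : ‖s‖ < 1) (k : ℤ) :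
    HasSum (fun m : ℕ => s ^ m ^ 2 * qPoch (-s) (s ^ 2) m *
      (invQPoch (s ^ 2) (m - k) * invQPoch (s ^ 2) (m + k)))
      (s ^ k ^ 2 * (qPochInf (-s) (s ^ 2) / qPochInf (s ^ 2) (s ^ 2))) := by
  obtain ⟨n, rfl | rfl⟩ := k.eq_nat_or_neg
  · exact_mod_cast hasSum_bailey_natCast hs n
  · simpa only [sub_neg_eq_add, ← sub_eq_add_neg, neg_sq, mul_comm (invQPoch _ (_ - _)),
      ← Nat.cast_pow, zpow_natCast] using hasSum_bailey_natCast hs n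

/-- The Gaussian binomial coefficient in base `p`, with integer lower index (and value `0` outside
the range `0 ≤ k ≤ N`). -/
noncomputable def qBinom (p : ℂ) (N : ℕ) (k : ℤ) : ℂ :=
  qPoch p p N * (invQPoch p k * invQPoch p (N - k))

theorem exists_norm_qBinom_le {p : ℂ} (hp : ‖p‖ < 1) : ∃ C, ∀ N k, ‖qBinom p N k‖ ≤ C := by
  obtain ⟨C, hC⟩ := exists_norm_qPoch_le hp p
  obtain ⟨D, hD⟩ := exists_norm_invQPoch_le hp
  have hC0 : 0 ≤ C := (norm_nonneg _).trans (hC 0)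
  have hD0 : 0 ≤ D := (norm_nonneg _).trans (hD 0)
  refine ⟨C * (D * D), fun N k => ?_⟩
  rw [qBinom, norm_mul, norm_mul]
  gcongr
  exacts [hC N, hD _, hD _]

theorem qBinom_two_mul (p : ℂ) (m : ℕ) (k : ℤ) :
    qBinom p (2 * m) (m + k) = qPoch p p (2 * m) * (invQPoch p (m - k) * invQPoch p (m + k)) := by
  rw [qBinom, mul_comm (invQPoch p (m + k))]
  congr 3
  push_cast
  ring

theorem hasSum_bailey_transform {s : ℂ} (hs : ‖s‖ < 1) {ι : Type*} {w : ι → ℂ}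
    (hw : Summable fun j => ‖w j‖) (κ : ι → ℤ) :
    HasSum (fun m : ℕ => s ^ m ^ 2 * qPoch (-s) (s ^ 2) m *
      ((∑' j, w j * qBinom (s ^ 2) (2 * m) (m + κ j)) / qPoch (s ^ 2) (s ^ 2) (2 * m)))
      (qPochInf (-s) (s ^ 2) / qPochInf (s ^ 2) (s ^ 2) * ∑' j, w j * s ^ κ j ^ 2) := by
  have hp := norm_pow_lt_one hs two_ne_zero
  obtain ⟨C, hC⟩ := exists_norm_qPoch_le hp (-s)
  obtain ⟨D, hD⟩ := exists_norm_invQPoch_le hp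
  have hC0 : 0 ≤ C := (norm_nonneg _).trans (hC 0)
  have hD0 : 0 ≤ D := (norm_nonneg _).trans (hD 0)
  set f : ℕ × ι → ℂ := fun x => w x.2 * (s ^ x.1 ^ 2 * qPoch (-s) (s ^ 2) x.1 *
    (invQPoch (s ^ 2) (x.1 - κ x.2) * invQPoch (s ^ 2) (x.1 + κ x.2))) with hf
  have hsq : Summable fun m : ℕ => ‖s ^ m ^ 2‖ :=
    (summable_norm_pow_choose_two_mul_pow hp s).congr fun m => by
      rw [← two_mul_choose_two_add, pow_add, pow_mul]
  have hsum : Summable f := by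
    refine .of_norm_bounded ((hsq.mul_of_nonneg hw (fun _ => norm_nonneg _)
      fun _ => norm_nonneg _).mul_left (C * (D * D))) fun x => ?_
    calc ‖f x‖ = ‖w x.2‖ * (‖s ^ x.1 ^ 2‖ * ‖qPoch (-s) (s ^ 2) x.1‖ *
          (‖invQPoch (s ^ 2) (x.1 - κ x.2)‖ * ‖invQPoch (s ^ 2) (x.1 + κ x.2)‖)) := by
          simp only [hf, norm_mul]
      _ ≤ ‖w x.2‖ * (‖s ^ x.1 ^ 2‖ * C * (D * D)) := by
          gcongr
          exacts [hC _, hD _, hD _]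
      _ = C * (D * D) * (‖s ^ x.1 ^ 2‖ * ‖w x.2‖) := by ring
  convert! hsum.hasSum.prod_fiberwise fun m => (hsum.prod_factor m).hasSum using 1
  · funext m
    rw [← tsum_div_const, ← tsum_mul_left]
    refine tsum_congr fun j => ?_
    have := qPoch_ne_zero hp hp.le (2 * m)
    simp only [qBinom_two_mul, hf]
    field_simp
  · rw [← (Equiv.prodComm ι ℕ).tsum_eq f, ← tsum_mul_left]
    refine .trans (tsum_congr fun j => ?_) (hsum.comp_injective
      (Equiv.prodComm ι ℕ).injective).tsum_prod.symm
    exact .trans (by ring) ((hasSum_bailey hs (κ j)).mul_left (w j)).tsum_eq.symm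

end bailey

section finiteTheta

theorem qBinom_eq_zero (p : ℂ) {N : ℕ} {k : ℤ} (h : k < 0 ∨ N < k) : qBinom p N k = 0 := by
  rcases h with h | h
  · rw [qBinom, invQPoch_of_neg p h, zero_mul, mul_zero]
  · rw [qBinom, invQPoch_of_neg p (sub_neg.2 h), mul_zero, mul_zero]

theorem qBinom_zero_left (p : ℂ) (k : ℤ) : qBinom p 0 k = if k = 0 then 1 else 0 := by
  split_ifs with hk
  · simp [hk, qBinom, invQPoch, qPoch_zero]
  · exact qBinom_eq_zero p (by lia)

theorem qBinom_symm (p : ℂ) (N : ℕ) (k : ℤ) : qBinom p N (N - k) = qBinom p N k := by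
  rw [qBinom, qBinom, sub_sub_cancel, mul_comm (invQPoch p k)]

theorem one_sub_zpow_mul_invQPoch {p : ℂ} (hp : ‖p‖ < 1) (k : ℤ) :
    (1 - p ^ k) * invQPoch p k = invQPoch p (k - 1) := by
  rcases lt_trichotomy k 0 with hk | rfl | hk
  · rw [invQPoch_of_neg p hk, invQPoch_of_neg p (by lia), mul_zero]
  · simp [invQPoch_of_neg]
  · obtain ⟨n, rfl⟩ : ∃ n : ℕ, k = n + 1 := ⟨(k - 1).toNat, by lia⟩
    rw [add_sub_cancel_right, invQPoch_natCast, ← Nat.cast_succ, invQPoch_natCast, zpow_natCast]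
    exact one_sub_pow_succ_mul_inv_qPoch hp n

/-- The bilateral sum `∑_j x^j u^{j²} [N; k + d j]_p`, with only finitely many nonzero terms:
a finite analogue of a theta series in `x`. -/
noncomputable def finiteTheta (p u : ℂ) (d : ℤ) (x : ℂ) (N : ℕ) (k : ℤ) : ℂ :=
  ∑' j : ℤ, x ^ j * u ^ j ^ 2 * qBinom p N (k + d * j)

theorem summable_mul_qBinom (p : ℂ) (w : ℤ → ℂ) (N : ℕ) (k : ℤ) {d : ℤ} (hd : d ≠ 0) :
    Summable fun j => w j * qBinom p N (k + d * j) := by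
  have hinj : Function.Injective fun j => k + d * j :=
    (add_right_injective k).comp (mul_right_injective₀ hd)
  refine summable_of_hasFiniteSupport (((Set.finite_Icc 0 (N : ℤ)).preimage hinj.injOn).subset
    fun j => ?_)
  contrapose!
  intro h
  rw [Function.notMem_support, qBinom_eq_zero p (by
    simpa only [Set.mem_preimage, Set.mem_Icc, not_and_or, not_le] using h), mul_zero]

theorem finiteTheta_inv (p u : ℂ) (d : ℤ) (x : ℂ) (N : ℕ) (k : ℤ) :
    finiteTheta p u d x⁻¹ N (N - k) = finiteTheta p u d x N k := by
  rw [finiteTheta, ← (Equiv.neg ℤ).tsum_eq]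
  refine tsum_congr fun j => ?_
  rw [Equiv.neg_apply, inv_zpow', neg_neg, neg_sq, ← qBinom_symm p N (k + d * j)]
  ring_nf

variable {p u x : ℂ} {d : ℤ}

theorem finiteTheta_zero_left (hd : d ≠ 0) : finiteTheta p u d x 0 0 = 1 := by
  rw [finiteTheta, tsum_eq_single 0 fun j hj => ?_]
  · simp [qBinom_zero_left]
  · rw [qBinom_zero_left, if_neg (by simp [hd, hj]), mul_zero]

theorem finiteTheta_shift (hu : u ≠ 0) (hx : x ≠ 0) (N : ℕ) (k : ℤ) :
    finiteTheta p u d x N k = x * u * finiteTheta p u d (x * u ^ 2) N (k + d) := by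
  rw [finiteTheta, ← (Equiv.addRight (1 : ℤ)).tsum_eq, finiteTheta, ← tsum_mul_left]
  refine tsum_congr fun j => ?_
  rw [Equiv.coe_addRight, zpow_add_one₀ hx, add_sq, one_pow, zpow_add_one₀ hu, zpow_add₀ hu,
    mul_zpow, ← zpow_natCast u 2, ← zpow_mul]
  ring_nf

variable (hp0 : p ≠ 0) (hp : ‖p‖ < 1)
include hp0 hp

theorem qBinom_succ (N : ℕ) (k : ℤ) :
    qBinom p (N + 1) k = qBinom p N (k - 1) + p ^ k * qBinom p N k := by
  have h1 := one_sub_zpow_mul_invQPoch hp k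
  have h2 := one_sub_zpow_mul_invQPoch hp ((N + 1 : ℕ) - k)
  have h3 : p ^ k * p ^ (((N + 1 : ℕ) : ℤ) - k) = p * p ^ N := by
    rw [← zpow_add₀ hp0, add_sub_cancel, zpow_natCast, pow_succ']
  simp only [qBinom, qPoch_succ]
  rw [show ((N : ℤ) - (k - 1)) = (N + 1 : ℕ) - k by push_cast; ring,
    show ((N : ℤ) - k) = (N + 1 : ℕ) - k - 1 by push_cast; ring, ← h1, ← h2, ← h3]
  ring

theorem finiteTheta_succ (hd : d ≠ 0) (N : ℕ) (k : ℤ) : finiteTheta p u d x (N + 1) k =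
    finiteTheta p u d x N (k - 1) + p ^ k * finiteTheta p u d (x * p ^ d) N k := by
  simp only [finiteTheta]
  rw [← tsum_mul_left, ← (summable_mul_qBinom p _ N (k - 1) hd).tsum_add
    ((summable_mul_qBinom p _ N k hd).mul_left _)]
  refine tsum_congr fun j => ?_
  rw [qBinom_succ hp0 hp, zpow_add₀ hp0, mul_zpow, zpow_mul]
  ring_nf

theorem finiteTheta_succ' (hd : d ≠ 0) (N : ℕ) (k : ℤ) : finiteTheta p u d x (N + 1) k =
    finiteTheta p u d x N k + p ^ (N + 1 - k) * finiteTheta p u d (x * p ^ (-d)) N (k - 1) := by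
  rw [← finiteTheta_inv, finiteTheta_succ hp0 hp hd, ← finiteTheta_inv p u d x N k,
    ← finiteTheta_inv p u d _ N (k - 1), mul_inv, zpow_neg, inv_inv]
  push_cast
  ring_nf

end finiteTheta

section cubicSum

/-- The sum `∑_j p^{6j²+bj} [N; k + 3j]_p` behind the polynomial identities that feed the Bailey
transform. -/
noncomputable def cubicSum (p : ℂ) (b : ℤ) (N : ℕ) (k : ℤ) : ℂ :=
  finiteTheta p (p ^ 6) 3 (p ^ b) N k

theorem cubicSum_eq_of_add_eq (p : ℂ) {b c k l : ℤ} {N : ℕ} (hbc : b + c = 0) (hkl : k + l = N) :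
    cubicSum p b N k = cubicSum p c N l := by
  rw [cubicSum, ← finiteTheta_inv, ← zpow_neg, ← eq_neg_of_add_eq_zero_right hbc,
    ← eq_sub_of_add_eq' hkl, cubicSum]

theorem cubicSum_zero_zero (p : ℂ) (b : ℤ) : cubicSum p b 0 0 = 1 :=
  finiteTheta_zero_left three_ne_zero

theorem cubicSum_zero_left {k : ℤ} (hk : ¬3 ∣ k) (p : ℂ) (b : ℤ) : cubicSum p b 0 k = 0 := by
  rw [cubicSum, finiteTheta, ← tsum_zero (α := ℂ) (β := ℤ)]
  refine tsum_congr fun j => ?_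
  rw [qBinom_zero_left, if_neg (by lia), mul_zero]

variable {p : ℂ} (hp0 : p ≠ 0)
include hp0

theorem cubicSum_eq_zpow_mul {b c k l : ℤ} {N : ℕ} (hbc : b + c = 12) (hkl : k + l = N + 3) :
    cubicSum p b N k = p ^ (6 - b) * cubicSum p c N l := by
  rw [cubicSum_eq_of_add_eq p (add_neg_cancel b) (add_sub_cancel k N), cubicSum,
    finiteTheta_shift (pow_ne_zero 6 hp0) (zpow_ne_zero _ hp0), cubicSum, ← pow_mul,
    ← zpow_natCast p 6, ← zpow_natCast p (6 * 2), ← zpow_add₀ hp0, ← zpow_add₀ hp0,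
    eq_sub_of_add_eq' hbc, eq_sub_of_add_eq' hkl]
  push_cast
  ring_nf

variable (hp : ‖p‖ < 1)
include hp

theorem cubicSum_succ (b : ℤ) (N : ℕ) (k : ℤ) :
    cubicSum p b (N + 1) k = cubicSum p b N (k - 1) + p ^ k * cubicSum p (b + 3) N k := by
  rw [cubicSum, finiteTheta_succ hp0 hp three_ne_zero, ← zpow_add₀ hp0]
  rfl

theorem cubicSum_succ' (b : ℤ) {N : ℕ} {k l : ℤ} (hkl : k + l = N + 1) :
    cubicSum p b (N + 1) k = cubicSum p b N k + p ^ l * cubicSum p (b - 3) N (k - 1) := by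
  rw [cubicSum, finiteTheta_succ' hp0 hp three_ne_zero, ← zpow_add₀ hp0, ← hkl,
    add_sub_cancel_left]
  rfl

theorem cubicSum_odd_sub_eq_even_sub (m : ℕ) :
    cubicSum p 1 (2 * m + 1) (m + 1) - p * cubicSum p 5 (2 * m + 1) (m + 2) =
      cubicSum p 1 (2 * m) m - p * cubicSum p 5 (2 * m) (m + 1) := by
  have h1 := cubicSum_succ hp0 hp 1 (2 * m) (m + 1)
  have h2 := cubicSum_succ hp0 hp 5 (2 * m) (m + 2)
  have h3 : cubicSum p 4 (2 * m) (m + 1) = p ^ (6 - 4 : ℤ) * cubicSum p 8 (2 * m) (m + 2) :=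
    cubicSum_eq_zpow_mul hp0 (by norm_num) (by push_cast; ring)
  norm_num [zpow_add₀ hp0, add_sub_assoc] at h1 h2 h3
  linear_combination h1 - p * h2 + p ^ m * p * h3

theorem cubicSum_even_sub_eq_odd_sub (m : ℕ) :
    cubicSum p 1 (2 * (m + 1)) (m + 1) - p * cubicSum p 5 (2 * (m + 1)) (m + 1 + 1) =
      cubicSum p 1 (2 * m + 1) (m + 1) - p * cubicSum p 5 (2 * m + 1) (m + 2) := by
  have h1 := cubicSum_succ' hp0 hp 1 (N := 2 * m + 1) (k := m + 1) (l := m + 1)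
    (by push_cast; ring)
  have h2 := cubicSum_succ' hp0 hp 5 (N := 2 * m + 1) (k := m + 2) (l := m)
    (by push_cast; ring)
  have h3 : cubicSum p (-2) (2 * m + 1) m = cubicSum p 2 (2 * m + 1) (m + 1) :=
    cubicSum_eq_of_add_eq p (by norm_num) (by push_cast; ring)
  norm_num [zpow_add₀ hp0, add_sub_assoc, add_assoc, mul_add] at h1 h2 h3 ⊢
  linear_combination h1 - p * h2 + p ^ m * p * h3

theorem cubicSum_even_sub (m : ℕ) :
    cubicSum p 1 (2 * m) m - p * cubicSum p 5 (2 * m) (m + 1) = 1 := by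
  induction m with
  | zero => norm_num [cubicSum_zero_zero, cubicSum_zero_left]
  | succ m ih =>
    rw [Nat.cast_succ, cubicSum_even_sub_eq_odd_sub hp0 hp, cubicSum_odd_sub_eq_even_sub hp0 hp, ih]

theorem cubicSum_odd_sub (m : ℕ) :
    cubicSum p 1 (2 * m + 1) (m + 1) - p * cubicSum p 5 (2 * m + 1) (m + 2) = 1 := by
  rw [cubicSum_odd_sub_eq_even_sub hp0 hp, cubicSum_even_sub hp0 hp]

theorem cubicSum_even_sub_eq_pow (m : ℕ) :
    cubicSum p 2 (2 * m) m - cubicSum p 2 (2 * m) (m + 1) = p ^ m := by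
  cases m with
  | zero => norm_num [cubicSum_zero_zero, cubicSum_zero_left]
  | succ m =>
    have h1 := cubicSum_succ' hp0 hp 2 (N := 2 * m + 1) (k := m + 1) (l := m + 1)
      (by push_cast; ring)
    have h2 := cubicSum_succ hp0 hp 2 (2 * m + 1) (m + 2)
    have h3 : cubicSum p (-1) (2 * m + 1) m = cubicSum p 1 (2 * m + 1) (m + 1) :=
      cubicSum_eq_of_add_eq p (by norm_num) (by push_cast; ring)
    have h4 := cubicSum_odd_sub hp0 hp m
    norm_num [zpow_add₀ hp0, add_sub_assoc, add_assoc, mul_add] at h1 h2 h3 h4 ⊢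
    linear_combination h1 - h2 + p ^ m * p * h3 + p ^ m * p * h4

theorem cubicSum_odd_sub_eq_pow (m : ℕ) :
    cubicSum p 4 (2 * m + 1) (m + 1) - cubicSum p 4 (2 * m + 1) (m + 2) = p ^ m := by
  have h1 := cubicSum_succ' hp0 hp 4 (N := 2 * m) (k := m + 1) (l := m) (by push_cast; ring)
  have h2 := cubicSum_succ hp0 hp 4 (2 * m) (m + 2)
  have h3 : cubicSum p 7 (2 * m) (m + 2) = p ^ (6 - 7 : ℤ) * cubicSum p 5 (2 * m) (m + 1) :=
    cubicSum_eq_zpow_mul hp0 (by norm_num) (by push_cast; ring)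
  have h4 := cubicSum_even_sub hp0 hp m
  norm_num [zpow_add₀ hp0, add_sub_assoc] at h1 h2 h3 h4
  rw [h3] at h2
  field_simp at h2
  linear_combination h1 - h2 + p ^ m * h4

theorem cubicSum_even_sub_eq_one_sub (m : ℕ) :
    cubicSum p 1 (2 * m) (m + 1) - p ^ 2 * cubicSum p 7 (2 * m) (m + 1) = 1 - p ^ (2 * m) := by
  cases m with
  | zero => norm_num [cubicSum_zero_left]
  | succ m =>
    have h1 := cubicSum_succ hp0 hp 1 (2 * m + 1) (m + 2)
    have h2 := cubicSum_succ' hp0 hp 7 (N := 2 * m + 1) (k := m + 2) (l := m) (by push_cast; ring)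
    have h3 : cubicSum p 7 (2 * m + 1) (m + 2) =
        p ^ (6 - 7 : ℤ) * cubicSum p 5 (2 * m + 1) (m + 2) :=
      cubicSum_eq_zpow_mul hp0 (by norm_num) (by push_cast; ring)
    have h4 := cubicSum_odd_sub hp0 hp m
    have h5 := cubicSum_odd_sub_eq_pow hp0 hp m
    norm_num [zpow_add₀ hp0, add_sub_assoc, add_assoc, mul_add] at h1 h2 h3 h4 h5 ⊢
    rw [h3] at h2
    field_simp at h2
    linear_combination h1 - p * h2 + h4 - p ^ m * p ^ 2 * h5

end cubicSum

section theta

theorem tendsto_invQPoch {p : ℂ} (hp : ‖p‖ < 1) :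
    Tendsto (invQPoch p) atTop (𝓝 (qPochInf p p)⁻¹) := by
  rw [← Nat.map_cast_int_atTop, tendsto_map'_iff]
  exact ((tendsto_qPoch hp p).inv₀ (qPochInf_ne_zero hp hp)).congr
    fun n => (invQPoch_natCast p n).symm

theorem tendsto_qBinom_two_mul {p : ℂ} (hp : ‖p‖ < 1) (k : ℤ) :
    Tendsto (fun n : ℕ => qBinom p (2 * n) (n + k)) atTop (𝓝 (qPochInf p p)⁻¹) := by
  have hne := qPochInf_ne_zero hp hp
  have hnum : Tendsto (fun n => qPoch p p (2 * n)) atTop (𝓝 (qPochInf p p)) :=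
    (tendsto_qPoch hp p).comp (tendsto_id.const_mul_atTop' two_pos)
  have hden (l : ℤ) : Tendsto (fun n : ℕ => invQPoch p (n + l)) atTop (𝓝 (qPochInf p p)⁻¹) :=
    (tendsto_invQPoch hp).comp
      (tendsto_atTop_add_const_right _ _ tendsto_natCast_atTop_atTop)
  simpa only [qBinom_two_mul, sub_eq_add_neg, mul_inv_cancel_left₀ hne] using
    hnum.mul ((hden (-k)).mul (hden k))

/-- The theta series `∑_j x^j t^{j²}` over the integers. -/
noncomputable def theta (t x : ℂ) : ℂ :=
  ∑' j : ℤ, x ^ j * t ^ j ^ 2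

theorem theta_inv (t x : ℂ) : theta t x⁻¹ = theta t x := by
  rw [theta, ← (Equiv.neg ℤ).tsum_eq]
  exact tsum_congr fun j => by rw [Equiv.neg_apply, inv_zpow', neg_neg, neg_sq]

variable {t x : ℂ} (ht0 : t ≠ 0) (hx : x ≠ 0)
include ht0 hx

theorem theta_eq_zpow_mul (m : ℤ) : theta t x = x ^ m * t ^ m ^ 2 * theta t (x * t ^ (2 * m)) := by
  rw [theta, ← (Equiv.addRight m).tsum_eq, theta, ← tsum_mul_left]
  refine tsum_congr fun j => ?_
  rw [Equiv.coe_addRight, zpow_add₀ hx, add_sq, zpow_add₀ ht0, zpow_add₀ ht0, mul_zpow, ← zpow_mul]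
  ring_nf

variable (ht : ‖t‖ < 1)
include ht

theorem finiteTheta_eq_qPoch_mul (n : ℕ) : finiteTheta (t ^ 2) t 1 x (2 * n) n =
    qPoch (-(x * t)) (t ^ 2) n * qPoch (-(t / x)) (t ^ 2) n := by
  have hp := norm_pow_lt_one ht two_ne_zero
  have hp0 : t ^ 2 ≠ 0 := pow_ne_zero 2 ht0
  induction n with
  | zero => simpa [qPoch_zero] using finiteTheta_zero_left one_ne_zero
  | succ n ih =>
    have heven : finiteTheta (t ^ 2) t 1 x (2 * n + 1 + 1) (n + 1) =
        (1 - -(x * t) * (t ^ 2) ^ n) * finiteTheta (t ^ 2) t 1 x (2 * n + 1) (n + 1) := by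
      rw [finiteTheta_succ' hp0 hp one_ne_zero, add_sub_cancel_right,
        finiteTheta_shift ht0 (mul_ne_zero hx (zpow_ne_zero _ hp0)) _ (n : ℤ),
        show ((2 * n + 1 : ℕ) + 1 - (n + 1) : ℤ) = (n + 1 : ℕ) by push_cast; ring, zpow_natCast,
        zpow_neg_one, inv_mul_cancel_right₀ hp0]
      field_simp
      ring
    have hodd : finiteTheta (t ^ 2) t 1 x (2 * n + 1) (n + 1) =
        (1 - -(t / x) * (t ^ 2) ^ n) * finiteTheta (t ^ 2) t 1 x (2 * n) n := by
      rw [finiteTheta_succ hp0 hp one_ne_zero, add_sub_cancel_right,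
        finiteTheta_shift ht0 hx _ (n : ℤ), zpow_add_one₀ hp0, zpow_natCast, zpow_one]
      field_simp
      ring
    rw [qPoch_succ, qPoch_succ, mul_mul_mul_comm, ← ih, Nat.cast_succ, mul_add_one]
    linear_combination heven + (1 - -(x * t) * (t ^ 2) ^ n) * hodd

theorem theta_eq_qPochInf_mul : theta t x =
    qPochInf (t ^ 2) (t ^ 2) * (qPochInf (-(x * t)) (t ^ 2) * qPochInf (-(t / x)) (t ^ 2)) := by
  have hp := norm_pow_lt_one ht two_ne_zero
  have hfinite : Tendsto (fun n : ℕ => finiteTheta (t ^ 2) t 1 x (2 * n) n) atTop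
      (𝓝 (∑' j : ℤ, x ^ j * t ^ j ^ 2 * (qPochInf (t ^ 2) (t ^ 2))⁻¹)) := by
    obtain ⟨C, hC⟩ := exists_norm_qBinom_le hp
    refine tendsto_tsum_of_dominated_convergence ((summable_norm_zpow_mul_zpow_sq ht x).mul_right C)
      (fun j => (tendsto_qBinom_two_mul hp _).const_mul _) (.of_forall fun n j => ?_)
    rw [norm_mul]
    gcongr
    exact hC _ _
  have hprod := ((tendsto_qPoch hp (-(x * t))).mul (tendsto_qPoch hp (-(t / x)))).congr
    fun n => (finiteTheta_eq_qPoch_mul ht0 hx ht n).symm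
  rw [tendsto_nhds_unique hprod hfinite, tsum_mul_right, theta,
    mul_comm, inv_mul_cancel_right₀ (qPochInf_ne_zero hp hp)]

end theta

section quintuple

theorem hasSum_theta_mul_theta {t u x y : ℂ} (ht0 : t ≠ 0) (ht : ‖t‖ < 1) (hu : ‖u‖ < 1)
    (hx : x ≠ 0) :
    HasSum (fun n : ℤ => x ^ n * t ^ n ^ 2 * theta (t ^ 4 * u) (y / x ^ 2 / t ^ (4 * n)))
      (theta t x * theta u y) := by
  have hsum := summable_mul_of_summable_norm (summable_norm_zpow_mul_zpow_sq ht x)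
    (summable_norm_zpow_mul_zpow_sq hu y)
  have hprod := (summable_norm_zpow_mul_zpow_sq ht x).of_norm.hasSum.mul
    (summable_norm_zpow_mul_zpow_sq hu y).of_norm.hasSum hsum
  let e : ℤ × ℤ ≃ ℤ × ℤ :=
    { toFun := fun v => (v.1 - 2 * v.2, v.2)
      invFun := fun v => (v.1 + 2 * v.2, v.2)
      left_inv := fun v => by simp
      right_inv := fun v => by simp }
  rw [← e.hasSum_iff] at hprod
  convert! hprod.prod_fiberwise fun n => (hprod.summable.prod_factor n).hasSum using 1
  funext n
  rw [theta, ← tsum_mul_left]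
  refine tsum_congr fun j => ?_
  simp only [Function.comp_apply, e, Equiv.coe_fn_mk, sub_sq, div_zpow, mul_zpow, zpow_sub₀ hx,
    zpow_add₀ ht0, zpow_sub₀ ht0]
  rw [← zpow_natCast x 2, ← zpow_natCast t 4, ← zpow_mul, ← zpow_mul, ← zpow_mul]
  field_simp
  ring_nf

theorem theta_neg_inv_self {t : ℂ} (ht0 : t ≠ 0) : theta t (-t⁻¹) = 0 := by
  have hshift := theta_eq_zpow_mul ht0 (neg_ne_zero.2 (inv_ne_zero ht0)) 1
  rw [show -t⁻¹ * t ^ (2 * 1 : ℤ) = (-t⁻¹)⁻¹ by rw [inv_neg, inv_inv]; field_simp; rfl,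
    theta_inv] at hshift
  norm_num [ht0] at hshift
  linear_combination hshift / 2

theorem theta_pow_three_neg_self {t : ℂ} (ht0 : t ≠ 0) (ht : ‖t‖ < 1) :
    theta (t ^ 3) (-t) = qPochInf (t ^ 2) (t ^ 2) := by
  rw [theta_eq_qPochInf_mul (pow_ne_zero 3 ht0) (neg_ne_zero.2 ht0)
      (norm_pow_lt_one ht three_ne_zero),
    qPochInf_eq_prod (norm_pow_lt_one ht two_ne_zero) (t ^ 2) three_ne_zero]
  simp only [prod_range_succ, prod_range_zero, div_neg, neg_neg, neg_mul]
  rw [show t ^ 3 / t = t ^ 2 by field_simp]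
  ring_nf

theorem theta_quintuple_term {t z : ℂ} (ht0 : t ≠ 0) (hz : z ≠ 0) (m r : ℤ) :
    (-(z / t)) ^ (m * 3 + r) * t ^ (m * 3 + r) ^ 2 *
        theta (t ^ 6) (-(t ^ 2 / t ^ (4 * (m * 3 + r)))) =
      (-z) ^ r * t ^ (r ^ 2 - r) * theta (t ^ 6) (-(t ^ 2 / t ^ (4 * r))) *
        ((z ^ 3 * t ^ (2 * r - 1)) ^ m * (t ^ 3) ^ m ^ 2) := by
  have hsign : (-1 : ℂ) ^ (m * 3 + r) * (-1) ^ m = (-1) ^ r := by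
    rw [← zpow_add₀ (by norm_num), show m * 3 + r + m = 2 * m + 2 * m + r by ring,
      zpow_add₀ (by norm_num), (even_two_mul m |>.add (even_two_mul m)).neg_one_zpow, one_mul]
  have hpow : t ^ (m * 3 + r) ^ 2 / t ^ (m * 3 + r) * (t ^ 2 / t ^ (4 * (m * 3 + r))) ^ m *
      (t ^ 6) ^ m ^ 2 = t ^ (r ^ 2 - r) * ((t ^ (2 * r - 1)) ^ m * (t ^ 3) ^ m ^ 2) := by
    simp only [← zpow_natCast t, ← zpow_mul, ← zpow_add₀ ht0, ← zpow_sub₀ ht0]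
    congr 1
    push_cast
    ring
  have hz3 : z ^ (m * 3 + r) = (z ^ 3) ^ m * z ^ r := by
    rw [zpow_add₀ hz, mul_comm m, zpow_mul]
    rfl
  have harg : -(t ^ 2 / t ^ (4 * (m * 3 + r))) * (t ^ 6) ^ (2 * m) = -(t ^ 2 / t ^ (4 * r)) := by
    simp only [neg_mul, ← zpow_natCast t, ← zpow_mul, ← zpow_add₀ ht0, ← zpow_sub₀ ht0]
    congr 2
    push_cast
    ring
  rw [theta_eq_zpow_mul (pow_ne_zero 6 ht0)
    (neg_ne_zero.2 (div_ne_zero (pow_ne_zero 2 ht0) (zpow_ne_zero _ ht0))) m, harg,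
    neg_eq_neg_one_mul (z / t), neg_eq_neg_one_mul (t ^ 2 / t ^ (4 * (m * 3 + r))),
    neg_eq_neg_one_mul z, mul_zpow, mul_zpow, mul_zpow, mul_zpow, div_zpow, hz3, ← hsign]
  linear_combination (-1) ^ (m * 3 + r) * (-1) ^ m * (z ^ 3) ^ m * z ^ r *
    theta (t ^ 6) (-(t ^ 2 / t ^ (4 * r))) * hpow

/-- The series side `∑_j (z^{3j} t^{3j²-j} - z^{3j+1} t^{3j²+j})` of the quintuple product
identity. -/
noncomputable def quintupleTheta (t z : ℂ) : ℂ :=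
  theta (t ^ 3) (z ^ 3 / t) - z * theta (t ^ 3) (z ^ 3 * t)

theorem quintupleTheta_mul_qPochInf {t z : ℂ} (ht0 : t ≠ 0) (ht : ‖t‖ < 1) (hz : z ≠ 0) :
    quintupleTheta t z * qPochInf (t ^ 4) (t ^ 4) =
      theta t (-(z / t)) * theta (t ^ 2) (-z ^ 2) := by
  have ht2 := norm_pow_lt_one ht two_ne_zero
  have hratio : -z ^ 2 / (-(z / t)) ^ 2 = -t ^ 2 := by field_simp
  have hprod := hasSum_theta_mul_theta (y := -z ^ 2) ht0 ht ht2
    (neg_ne_zero.2 (div_ne_zero hz ht0))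
  simp only [hratio, ← pow_add, neg_div, Nat.reduceAdd] at hprod
  have hzero : theta (t ^ 6) (-t ^ 2) = qPochInf (t ^ 4) (t ^ 4) := by
    have h := theta_pow_three_neg_self (pow_ne_zero 2 ht0) ht2
    ring_nf at h ⊢
    exact h
  have hone : theta (t ^ 6) (-(t ^ 2 / t ^ 4)) = qPochInf (t ^ 4) (t ^ 4) := by
    rw [← hzero, ← theta_inv]
    congr 1
    field_simp
  have htwo : theta (t ^ 6) (-(t ^ 2 / t ^ 8)) = 0 := by
    rw [← theta_neg_inv_self (pow_ne_zero 6 ht0)]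
    congr 1
    field_simp
  have hsplit := ((Int.divModEquiv 3).symm.hasSum_iff.2 hprod).prod_fiberwise
    fun m => hasSum_fintype _
  simp only [Function.comp_apply, Fin.sum_univ_three, Int.divModEquiv_symm_apply,
    Fin.val_zero, Fin.val_one, Fin.val_two, Nat.cast_zero, Nat.cast_one, Nat.cast_ofNat,
    theta_quintuple_term ht0 hz] at hsplit
  norm_num [hzero, hone, htwo, zpow_ofNat, zpow_neg_one, mul_assoc] at hsplit
  have hsum (x : ℂ) := (summable_norm_zpow_mul_zpow_sq
    (norm_pow_lt_one ht three_ne_zero) x).of_norm.hasSum.mul_left (qPochInf (t ^ 4) (t ^ 4))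
  have htarget := (hsum (z ^ 3 * t⁻¹)).add ((hsum (z ^ 3 * t)).mul_left (-z))
  refine Eq.trans ?_ (htarget.unique ?_)
  · rw [quintupleTheta, theta, theta, div_eq_mul_inv]
    ring
  · simpa only [mul_assoc, neg_mul] using hsplit

end quintuple

section thetaProduct

theorem theta_eq_Jtheta {q : ℂ} (hq0 : q ≠ 0) (hq : ‖q‖ < 1) {a m : ℕ} (hm : m ≠ 0)
    (ham : a ≤ 2 * m) : theta (q ^ m) (-(q ^ a / q ^ m)) = Jtheta q a (2 * m) := by
  have hqm := pow_ne_zero m hq0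
  rw [theta_eq_qPochInf_mul hqm (neg_ne_zero.2 (div_ne_zero (pow_ne_zero a hq0) hqm))
    (norm_pow_lt_one hq hm), Jtheta, pow_sub₀ q hq0 ham, mul_comm 2 m, pow_mul, div_neg, neg_neg,
    neg_mul, neg_neg, div_mul_cancel₀ _ hqm, mul_comm, show q ^ m / (q ^ a / q ^ m) =
      (q ^ m) ^ 2 * (q ^ a)⁻¹ by field_simp]

theorem quintupleTheta_mul_J {q : ℂ} (hq0 : q ≠ 0) (hq : ‖q‖ < 1) {a m : ℕ} (hm : m ≠ 0)
    (ham : a ≤ m) :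
    quintupleTheta (q ^ m) (q ^ a) * J q (4 * m) =
      Jtheta q a (2 * m) * Jtheta q (2 * m - 2 * a) (4 * m) := by
  have hquintuple := quintupleTheta_mul_qPochInf (pow_ne_zero m hq0) (norm_pow_lt_one hq hm)
    (pow_ne_zero a hq0)
  rw [theta_eq_Jtheta hq0 hq hm (by lia), ← theta_inv ((q ^ m) ^ 2),
    show (-(q ^ a) ^ 2)⁻¹ = -(q ^ (2 * m - 2 * a) / q ^ (2 * m)) by
      rw [pow_sub₀ q hq0 (by lia)]; field_simp; ring, ← pow_mul q m 2, mul_comm m 2,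
    theta_eq_Jtheta hq0 hq (by lia) (by lia)] at hquintuple
  rw [J]
  convert! hquintuple using 3 <;> ring_nf

theorem Jtheta_mul_Jtheta_mul_Jtheta_neg {q : ℂ} (hq : ‖q‖ < 1) {a m : ℕ} (ha : Odd a)
    (hm : m ≠ 0) (ham : a ≤ 2 * m) :
    Jtheta q a (4 * m) * Jtheta q (2 * m - a) (4 * m) * Jtheta (-q) a (2 * m) =
      J q (2 * m) * Jtheta q (2 * a) (4 * m) * J q (4 * m) := by
  have hq2m := norm_pow_lt_one hq (n := 2 * m) (by lia)
  have hsplit (b : ℕ) : qPochInf (q ^ b) (q ^ (2 * m)) =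
      qPochInf (q ^ b) (q ^ (4 * m)) * qPochInf (q ^ (2 * m + b)) (q ^ (4 * m)) := by
    rw [qPochInf_eq_prod hq2m _ two_ne_zero, prod_range_succ, prod_range_one]
    ring_nf
  have hsq (b : ℕ) : qPochInf (q ^ (2 * b)) (q ^ (4 * m)) =
      qPochInf (q ^ b) (q ^ (2 * m)) * qPochInf (-q ^ b) (q ^ (2 * m)) := by
    rw [← qPochInf_sq hq2m]
    ring_nf
  have hodd : Odd (2 * m - a) := Nat.Even.sub_odd ham (even_two_mul m) ha
  simp only [Jtheta, J, (even_two_mul m).neg_pow, ha.neg_pow, hodd.neg_pow]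
  rw [show 4 * m - 2 * a = 2 * (2 * m - a) by lia, hsq a, hsq (2 * m - a), hsplit a,
    hsplit (2 * m - a), show 2 * m + (2 * m - a) = 4 * m - a by lia,
    show 4 * m - (2 * m - a) = 2 * m + a by lia]
  ring

theorem quintupleTheta_neg_mul_Jtheta {q : ℂ} (hq0 : q ≠ 0) (hq : ‖q‖ < 1) {a m : ℕ} (ha : Odd a)
    (ham : a ≤ m) :
    quintupleTheta ((-q) ^ m) ((-q) ^ a) * (Jtheta q a (4 * m) * Jtheta q (2 * m - a) (4 * m)) =
      J q (2 * m) * Jtheta q (2 * a) (4 * m) * Jtheta q (2 * m - 2 * a) (4 * m) := by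
  have hm : m ≠ 0 := by grind
  have hq4m := norm_pow_lt_one hq (n := 4 * m) (by lia)
  have hJ : J q (4 * m) ≠ 0 := qPochInf_ne_zero hq4m hq4m
  have hquintuple := quintupleTheta_mul_J (neg_ne_zero.2 hq0) (by rwa [norm_neg]) hm ham
  have hneg : J (-q) (4 * m) = J q (4 * m) ∧
      Jtheta (-q) (2 * m - 2 * a) (4 * m) = Jtheta q (2 * m - 2 * a) (4 * m) := by
    have h4m : Even (4 * m) := ⟨2 * m, by lia⟩
    have heven : Even (2 * m - 2 * a) := ⟨m - a, by lia⟩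
    have heven' : Even (4 * m - (2 * m - 2 * a)) := ⟨m + a, by lia⟩
    simp only [J, Jtheta, h4m.neg_pow, heven.neg_pow, heven'.neg_pow, and_self]
  rw [hneg.1, hneg.2] at hquintuple
  refine mul_right_cancel₀ hJ ?_
  linear_combination Jtheta q a (4 * m) * Jtheta q (2 * m - a) (4 * m) * hquintuple +
    Jtheta q (2 * m - 2 * a) (4 * m) * Jtheta_mul_Jtheta_mul_Jtheta_neg hq ha hm (by lia)

theorem J_mul_J_seven_mul_sq {q : ℂ} (hq : ‖q‖ < 1) {k : ℕ} (hk : k ≠ 0) :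
    J q k * J q (7 * k) ^ 2 =
      Jtheta q k (7 * k) * Jtheta q (2 * k) (7 * k) * Jtheta q (3 * k) (7 * k) := by
  rw [J, qPochInf_eq_prod (norm_pow_lt_one hq hk) _ (n := 7) (by norm_num)]
  simp only [J, Jtheta, prod_range_succ, prod_range_zero, show 7 * k - k = 6 * k by lia,
    show 7 * k - 2 * k = 5 * k by lia, show 7 * k - 3 * k = 4 * k by lia]
  ring_nf

end thetaProduct

section slater

variable {s : ℂ} (hs0 : s ≠ 0) (hs : ‖s‖ < 1)
include hs0 hs

theorem hasSum_cubicSum (b c : ℤ) :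
    HasSum (fun m : ℕ => s ^ m ^ 2 * qPoch (-s) (s ^ 2) m *
      (cubicSum (s ^ 2) b (2 * m) (m + c) / qPoch (s ^ 2) (s ^ 2) (2 * m)))
      (qPochInf (-s) (s ^ 2) / qPochInf (s ^ 2) (s ^ 2) *
        (s ^ c ^ 2 * theta ((s ^ 7) ^ 3) (s ^ (2 * b + 6 * c)))) := by
  have hw := summable_norm_zpow_mul_zpow_sq
    (norm_pow_lt_one (norm_pow_lt_one hs two_ne_zero) (n := 6) (by norm_num)) ((s ^ 2) ^ b)
  convert! hasSum_bailey_transform hs hw fun j => c + 3 * j using 1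
  · simp only [cubicSum, finiteTheta, add_assoc]
  · rw [theta, ← tsum_mul_left]
    refine congrArg _ (tsum_congr fun j => ?_)
    simp only [← zpow_natCast, ← zpow_mul, ← zpow_add₀ hs0]
    congr 1
    push_cast
    ring

theorem hasSum_slater_one :
    HasSum (fun m : ℕ => s ^ m ^ 2 * qPoch (-s) (s ^ 2) m *
      ((s ^ 2) ^ m / qPoch (s ^ 2) (s ^ 2) (2 * m)))
      (qPochInf (-s) (s ^ 2) / qPochInf (s ^ 2) (s ^ 2) * quintupleTheta (s ^ 7) (s ^ 1)) := by
  convert! (hasSum_cubicSum hs0 hs 2 0).sub (hasSum_cubicSum hs0 hs 2 1) using 1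
  · funext m
    rw [← cubicSum_even_sub_eq_pow (pow_ne_zero 2 hs0) (norm_pow_lt_one hs two_ne_zero), add_zero]
    ring
  · rw [quintupleTheta, ← theta_inv _ ((s ^ 1) ^ 3 / _)]
    norm_num [zpow_ofNat]
    field_simp

theorem hasSum_slater_three :
    HasSum (fun m : ℕ => s ^ m ^ 2 * qPoch (-s) (s ^ 2) m *
      (1 / qPoch (s ^ 2) (s ^ 2) (2 * m)))
      (qPochInf (-s) (s ^ 2) / qPochInf (s ^ 2) (s ^ 2) * quintupleTheta (s ^ 7) (s ^ 3)) := by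
  convert! (hasSum_cubicSum hs0 hs 1 0).sub ((hasSum_cubicSum hs0 hs 5 1).mul_left (s ^ 2)) using 1
  · funext m
    rw [← cubicSum_even_sub (pow_ne_zero 2 hs0) (norm_pow_lt_one hs two_ne_zero) m, add_zero]
    ring
  · rw [quintupleTheta]
    norm_num [zpow_ofNat]
    field_simp

theorem hasSum_slater_five :
    HasSum (fun m : ℕ => s ^ m ^ 2 * qPoch (-s) (s ^ 2) m *
      ((1 - (s ^ 2) ^ (2 * m)) / qPoch (s ^ 2) (s ^ 2) (2 * m)))
      (qPochInf (-s) (s ^ 2) / qPochInf (s ^ 2) (s ^ 2) *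
        (s * quintupleTheta (s ^ 7) (s ^ 5))) := by
  have hreflect : theta ((s ^ 7) ^ 3) (s ^ 20) = s * theta ((s ^ 7) ^ 3) (s ^ 22) := by
    rw [← theta_inv, theta_eq_zpow_mul (pow_ne_zero 3 (pow_ne_zero 7 hs0))
      (inv_ne_zero (pow_ne_zero 20 hs0)) 1]
    norm_num [zpow_ofNat]
    field_simp
  convert! (hasSum_cubicSum hs0 hs 1 1).sub
    ((hasSum_cubicSum hs0 hs 7 1).mul_left ((s ^ 2) ^ 2)) using 1
  · funext m
    rw [← cubicSum_even_sub_eq_one_sub (pow_ne_zero 2 hs0) (norm_pow_lt_one hs two_ne_zero) m]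
    ring
  · rw [quintupleTheta]
    norm_num [zpow_ofNat, hreflect]
    field_simp

end slater

section doubleSum

open PowerSeries in
theorem hasSum_mul_coeff_mul {R : Type*} [CommSemiring R] [TopologicalSpace R] [RegularSpace R]
    [ContinuousAdd R] {W : ℕ → R} {F G : PowerSeries R} {S : R}
    (h : HasSum (fun x : ℕ × ℕ => W (x.1 + x.2) * (coeff x.1 F * coeff x.2 G)) S) :
    HasSum (fun n => W n * coeff n (F * G)) S := by
  convert! hasSum_antidiagonal h using 1
  funext n
  rw [coeff_mul, mul_sum]
  exact sum_congr rfl fun x hx => by rw [mem_antidiagonal.1 hx]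

open PowerSeries in
theorem hasSum_mul_coeff_of_hasSum_mul_expand {R : Type*} [CommRing R] [TopologicalSpace R]
    [RegularSpace R] [T2Space R] [ContinuousAdd R]
    {W : ℕ → R} {F G : PowerSeries R} {S : R} {k : ℕ} (hk : k ≠ 0)
    (hsum : Summable fun x : ℕ × ℕ => W (x.1 + k * x.2) * (coeff x.1 F * coeff x.2 G))
    (h : HasSum (fun n => W n * coeff n (F * expand k hk G)) S) :
    HasSum (fun x : ℕ × ℕ => W (x.1 + k * x.2) * (coeff x.1 F * coeff x.2 G)) S := by
  let g : ℕ × ℕ → ℕ × ℕ := fun x => (x.1, k * x.2)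
  have hg : Function.Injective g :=
    Function.injective_id.prodMap (mul_right_injective₀ hk)
  have hrange (x) (hx : x ∉ Set.range g) :
      W (x.1 + x.2) * (coeff x.1 F * coeff x.2 (expand k hk G)) = 0 := by
    rw [coeff_expand, if_neg, mul_zero, mul_zero]
    rintro ⟨l, hl⟩
    exact hx ⟨(x.1, l), Prod.ext rfl hl.symm⟩
  have hcomp : (fun x => W (x.1 + x.2) * (coeff x.1 F * coeff x.2 (expand k hk G))) ∘ g =
      fun x => W (x.1 + k * x.2) * (coeff x.1 F * coeff x.2 G) := by
    funext x
    simp only [Function.comp_apply, g, coeff_expand, dvd_mul_right, if_true,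
      Nat.mul_div_cancel_left _ (Nat.pos_of_ne_zero hk)]
  obtain ⟨T, hT⟩ := hsum
  have hpair : HasSum (fun x : ℕ × ℕ =>
      W (x.1 + x.2) * (coeff x.1 F * coeff x.2 (expand k hk G))) T :=
    (hg.hasSum_iff hrange).1 (by rwa [hcomp])
  rwa [h.unique (hasSum_mul_coeff_mul hpair)]

theorem hasSum_prod_of_fiberwise {α β γ : Type*} [AddCommMonoid α] [TopologicalSpace α]
    [ContinuousAdd α] [RegularSpace α] [T2Space α] {f : β × γ → α} {g : β → α} {a : α}
    (hf : Summable f) (hfiber : ∀ b, HasSum (fun c => f (b, c)) (g b)) (hg : HasSum g a) :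
    HasSum f a := by
  rw [hg.unique (hf.hasSum.prod_fiberwise hfiber)]
  exact hf.hasSum

theorem summable_mul_mul_of_norm_le {β γ : Type*} {f : β → ℝ} {g : γ → ℝ} {w : β × γ → ℂ}
    {u : β → ℂ} {v : γ → ℂ} (hf : Summable f) (hg : Summable g) (hf0 : 0 ≤ f) (hg0 : 0 ≤ g)
    (hw : ∀ x, ‖w x‖ ≤ f x.1 * g x.2) (hu : ∃ C, ∀ b, ‖u b‖ ≤ C) (hv : ∃ C, ∀ c, ‖v c‖ ≤ C) :
    Summable fun x : β × γ => w x * (u x.1 * v x.2) := by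
  obtain ⟨C, hC⟩ := hu
  obtain ⟨D, hD⟩ := hv
  refine ((hf.mul_of_nonneg hg hf0 hg0).mul_right (C * D)).of_norm_bounded fun x => ?_
  rw [norm_mul, norm_mul]
  exact mul_le_mul (hw x)
    (mul_le_mul (hC _) (hD _) (norm_nonneg _) ((norm_nonneg _).trans (hC x.1)))
    (by positivity) (mul_nonneg (hf0 _) (hg0 _))

theorem norm_pow_le_pow {q : ℂ} (hq : ‖q‖ < 1) {m n : ℕ} (h : m ≤ n) : ‖q ^ n‖ ≤ ‖q‖ ^ m := by
  rw [norm_pow]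
  exact pow_le_pow_of_le_one (norm_nonneg q) hq.le h

theorem summable_pow_mul_mul {q : ℂ} (hq : ‖q‖ < 1) {E : ℕ × ℕ → ℕ} (hE : ∀ x, x.1 + x.2 ≤ E x)
    {u v : ℕ → ℂ} (hu : ∃ C, ∀ n, ‖u n‖ ≤ C) (hv : ∃ C, ∀ n, ‖v n‖ ≤ C) :
    Summable fun x : ℕ × ℕ => q ^ E x * (u x.1 * v x.2) := by
  have hgeom := summable_geometric_of_lt_one (norm_nonneg q) hq
  refine summable_mul_mul_of_norm_le hgeom hgeom (fun _ => by positivity) (fun _ => by positivity)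
    (fun x => ?_) hu hv
  rw [← pow_add]
  exact norm_pow_le_pow hq (hE x)

/-- The term `q^{E(i,j)} / ((q⁴; q⁴)_i (q⁴; q⁴)_j)` of a double sum; the triple sums reduce to
double sums of this shape. -/
noncomputable def pairTerm (q : ℂ) (E : ℕ → ℕ → ℕ) (x : ℕ × ℕ) : ℂ :=
  q ^ E x.1 x.2 * ((qPoch (q ^ 4) (q ^ 4) x.1)⁻¹ * (qPoch (q ^ 4) (q ^ 4) x.2)⁻¹)

theorem summable_pairTerm {q : ℂ} (hq : ‖q‖ < 1) {E : ℕ → ℕ → ℕ} (hE : ∀ i j, i + j ≤ E i j) :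
    Summable (pairTerm q E) := by
  have hq4 := norm_pow_lt_one hq four_ne_zero
  have hbound := exists_norm_inv_qPoch_le hq4 hq4
  have hsum := summable_pow_mul_mul hq (E := fun x => E x.1 x.2) (fun x => hE x.1 x.2) hbound hbound
  exact hsum

theorem hasSum_pairTerm_swap {q : ℂ} {E : ℕ → ℕ → ℕ} {S : ℂ} (h : HasSum (pairTerm q E) S) :
    HasSum (pairTerm q fun i j => E j i) S := by
  convert! (Equiv.prodComm ℕ ℕ).hasSum_iff.2 h using 1
  funext x
  simp only [pairTerm, Function.comp_apply, Equiv.prodComm_apply, Prod.fst_swap, Prod.snd_swap,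
    mul_comm (qPoch _ _ x.1)⁻¹]

/-- The exponents `3i² + 4ij + 4j² + (γ + 2δ - 2)i + 2γj` of the double sums, written so that
everything is visibly a natural number. -/
def pairExponent (γ δ i j : ℕ) : ℕ :=
  (i + 2 * j) ^ 2 + γ * (i + 2 * j) + 4 * i.choose 2 + 2 * δ * i

theorem add_le_pairExponent (γ δ i j : ℕ) : i + j ≤ pairExponent γ δ i j := by
  have hsq := Nat.le_self_pow two_ne_zero (i + 2 * j)
  rw [pairExponent]
  lia

open PowerSeries in
theorem hasSum_rescale_eulerSeries_mul_eulerSeries {q y S : ℂ} (hq : ‖q‖ < 1) (hy : ‖y‖ ≤ 1)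
    {γ : ℕ} (h : HasSum (fun m : ℕ => q ^ (m ^ 2 + γ * m) * y ^ m *
      (qPochInf (-q ^ (1 + γ + 2 * m)) (q ^ 2) / qPoch (q ^ 4) (q ^ 4) m)) S) :
    HasSum (fun n => q ^ (n ^ 2 + γ * n) *
      coeff n (rescale y (eulerSeries (q ^ 4)) * eulerSeries (q ^ 2))) S := by
  have hq2 := norm_pow_lt_one hq two_ne_zero
  have hq4 := norm_pow_lt_one hq four_ne_zero
  obtain ⟨C, hC⟩ := exists_norm_inv_qPoch_le hq4 hq4
  refine hasSum_mul_coeff_mul (hasSum_prod_of_fiberwise ?_ (fun m => ?_) h)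
  · refine summable_pow_mul_mul hq (E := fun x => (x.1 + x.2) ^ 2 + γ * (x.1 + x.2))
      (u := fun n => coeff n (rescale y (eulerSeries (q ^ 4))))
      (v := fun n => coeff n (eulerSeries (q ^ 2)))
      (fun x => ?_) ⟨C, fun n => ?_⟩ ?_
    · exact (Nat.le_self_pow two_ne_zero _).trans (Nat.le_add_right _ _)
    · rw [coeff_rescale, eulerSeries, coeff_mk, norm_mul, norm_pow]
      exact (mul_le_of_le_one_left (norm_nonneg _) (pow_le_one₀ (norm_nonneg y) hy)).trans (hC n)
    · simpa only [eulerSeries, coeff_mk] using exists_norm_inv_qPoch_le hq2 hq2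
  · have heuler := (hasSum_euler hq2 (-q ^ (1 + γ + 2 * m))).mul_left
      (q ^ (m ^ 2 + γ * m) * y ^ m * (qPoch (q ^ 4) (q ^ 4) m)⁻¹)
    convert! heuler using 1
    · funext a
      simp only [coeff_rescale, eulerSeries, coeff_mk, neg_neg]
      have hexp : (m + a) ^ 2 + γ * (m + a) =
          m ^ 2 + γ * m + 2 * a.choose 2 + (1 + γ + 2 * m) * a := by
        linear_combination -two_mul_choose_two_add a
      rw [hexp]
      ring
    · ring

open PowerSeries in
theorem pairTerm_pairExponent (q : ℂ) (γ δ : ℕ) (x : ℕ × ℕ) : pairTerm q (pairExponent γ δ) x =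
    q ^ ((x.1 + 2 * x.2) ^ 2 + γ * (x.1 + 2 * x.2)) *
      (coeff x.1 (rescale ((q ^ 2) ^ δ) (dualEulerSeries (q ^ 4))) *
        coeff x.2 (eulerSeries (q ^ 4))) := by
  simp only [pairTerm, pairExponent, coeff_rescale, dualEulerSeries, eulerSeries, coeff_mk]
  ring

open PowerSeries in
theorem hasSum_pairTerm_pairExponent {q y S : ℂ} (hq : ‖q‖ < 1) (hy : ‖y‖ ≤ 1) {γ δ : ℕ}
    (hF : rescale ((q ^ 2) ^ δ) (dualEulerSeries ((q ^ 2) ^ 2)) * evenEulerSeries (q ^ 2) =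
      eulerSeries (q ^ 2) * rescale y (eulerSeries ((q ^ 2) ^ 2)))
    (h : HasSum (fun m : ℕ => q ^ (m ^ 2 + γ * m) * y ^ m *
      (qPochInf (-q ^ (1 + γ + 2 * m)) (q ^ 2) / qPoch (q ^ 4) (q ^ 4) m)) S) :
    HasSum (pairTerm q (pairExponent γ δ)) S := by
  have hq4 : (q ^ 2) ^ 2 = q ^ 4 := (pow_mul q 2 2).symm
  rw [evenEulerSeries, hq4, mul_comm (eulerSeries (q ^ 2))] at hF
  have hsingle := hasSum_rescale_eulerSeries_mul_eulerSeries hq hy h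
  rw [← hF] at hsingle
  have hsum := (summable_pairTerm hq (add_le_pairExponent γ δ)).congr
    (pairTerm_pairExponent q γ δ)
  have hpair := hasSum_mul_coeff_of_hasSum_mul_expand (W := fun n => q ^ (n ^ 2 + γ * n))
    two_ne_zero hsum hsingle
  exact hpair.congr_fun (pairTerm_pairExponent q γ δ)

end doubleSum

section pairSum

theorem qPoch_two_mul (a p : ℂ) (n : ℕ) :
    qPoch a p (2 * n) = qPoch a (p ^ 2) n * qPoch (a * p) (p ^ 2) n := by
  induction n with
  | zero => simp [qPoch_zero]
  | succ n ih =>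
    rw [mul_add_one, qPoch_succ, qPoch_succ, qPoch_succ, qPoch_succ, ih]
    ring

variable {q : ℂ}

theorem qPochInf_neg_pow_div_qPoch (hq : ‖q‖ < 1) (m : ℕ) :
    qPochInf (-q ^ (1 + 2 * m)) (q ^ 2) / qPoch (q ^ 4) (q ^ 4) m =
      qPochInf (-q) (q ^ 2) * (qPoch q (q ^ 2) m / qPoch (q ^ 2) (q ^ 2) (2 * m)) := by
  have hq2 := norm_pow_lt_one hq two_ne_zero
  have hq4 := norm_pow_lt_one hq four_ne_zero
  have hpos := qPoch_ne_zero hq hq2.le m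
  have hneg := qPoch_ne_zero (a := -q) (by rwa [norm_neg]) hq2.le m
  have hfour := qPoch_ne_zero hq4 hq4.le m
  rw [qPoch_two_mul, qPoch_sq, qPochInf_eq_mul hq2 (-q) m, ← pow_add, ← pow_mul, ← pow_mul,
    show -q * q ^ (2 * m) = -q ^ (1 + 2 * m) by ring]
  field_simp

theorem qPochInf_neg_mul_div (hq : ‖q‖ < 1) :
    qPochInf (-q) (q ^ 2) * (qPochInf q (q ^ 2) / qPochInf (q ^ 2) (q ^ 2)) = (J q 4)⁻¹ := by
  have hq2 := norm_pow_lt_one hq two_ne_zero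
  have hq4 := norm_pow_lt_one hq four_ne_zero
  have htwo : qPochInf (q ^ 2) (q ^ 4) ≠ 0 := qPochInf_ne_zero hq4 hq2
  have hfour : J q 4 ≠ 0 := qPochInf_ne_zero hq4 hq4
  have hsplit : qPochInf (q ^ 2) (q ^ 2) = qPochInf (q ^ 2) (q ^ 4) * J q 4 := by
    rw [J, qPochInf_eq_prod hq2 _ two_ne_zero, prod_range_succ, prod_range_one]
    ring_nf
  have hsq := qPochInf_sq hq2 q
  rw [← pow_mul] at hsq
  rw [hsplit, mul_div_assoc', mul_comm (qPochInf (-q) _), ← hsq]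
  field_simp

theorem hasSum_div_J_four (hq : ‖q‖ < 1) {c : ℕ → ℂ} {T : ℂ}
    (h : HasSum (fun m : ℕ => (-q) ^ m ^ 2 * qPoch (-(-q)) ((-q) ^ 2) m *
      (c m / qPoch ((-q) ^ 2) ((-q) ^ 2) (2 * m)))
      (qPochInf (-(-q)) ((-q) ^ 2) / qPochInf ((-q) ^ 2) ((-q) ^ 2) * T)) :
    HasSum (fun m : ℕ => (-q) ^ m ^ 2 * c m *
      (qPochInf (-q ^ (1 + 2 * m)) (q ^ 2) / qPoch (q ^ 4) (q ^ 4) m)) (T / J q 4) := by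
  simp only [neg_neg, neg_sq] at h
  convert! h.mul_left (qPochInf (-q) (q ^ 2)) using 1
  · funext m
    rw [qPochInf_neg_pow_div_qPoch hq]
    ring
  · rw [← mul_assoc, qPochInf_neg_mul_div hq]
    ring

theorem neg_pow_sq {R : Type*} [Ring R] (a : R) (m : ℕ) : (-a) ^ m ^ 2 = (-1) ^ m * a ^ m ^ 2 := by
  rcases m.even_or_odd with h | h
  · rw [h.neg_one_pow, (h.pow_of_ne_zero two_ne_zero).neg_pow, one_mul]
  · rw [h.neg_one_pow, h.pow.neg_pow, neg_one_mul]

theorem hasSum_pairTerm_quintupleTheta_one (hq0 : q ≠ 0) (hq : ‖q‖ < 1) :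
    HasSum (pairTerm q (pairExponent 0 0)) (quintupleTheta ((-q) ^ 7) ((-q) ^ 1) / J q 4) := by
  have hq2 := norm_pow_lt_one hq two_ne_zero
  refine hasSum_pairTerm_pairExponent hq (y := -q ^ 2) (by rw [norm_neg]; exact hq2.le) ?_ ?_
  · rw [pow_zero, PowerSeries.rescale_one, RingHom.id_apply]
    exact dualEulerSeries_sq_mul_evenEulerSeries hq2
  · convert! hasSum_div_J_four hq (hasSum_slater_one (neg_ne_zero.2 hq0) (by rwa [norm_neg]))
      using 1
    funext m
    rw [neg_pow_sq, add_zero, zero_mul, add_zero, neg_sq, neg_pow (q ^ 2)]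
    ring

theorem hasSum_pairTerm_quintupleTheta_three (hq0 : q ≠ 0) (hq : ‖q‖ < 1) :
    HasSum (pairTerm q (pairExponent 0 1)) (quintupleTheta ((-q) ^ 7) ((-q) ^ 3) / J q 4) := by
  have hq2 := norm_pow_lt_one hq two_ne_zero
  refine hasSum_pairTerm_pairExponent hq (y := -1) (by rw [norm_neg, norm_one]) ?_ ?_
  · rw [pow_one]
    exact rescale_dualEulerSeries_sq_mul_evenEulerSeries hq2
  · convert! hasSum_div_J_four hq (hasSum_slater_three (neg_ne_zero.2 hq0) (by rwa [norm_neg]))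
      using 1
    funext m
    rw [neg_pow_sq, add_zero, zero_mul, add_zero]
    ring

theorem hasSum_pairTerm_quintupleTheta_five (hq0 : q ≠ 0) (hq : ‖q‖ < 1) :
    HasSum (pairTerm q (pairExponent 2 1)) (quintupleTheta ((-q) ^ 7) ((-q) ^ 5) / J q 4) := by
  have hq2 := norm_pow_lt_one hq two_ne_zero
  have hq4 := norm_pow_lt_one hq four_ne_zero
  refine hasSum_pairTerm_pairExponent hq (y := -1) (by rw [norm_neg, norm_one]) ?_ ?_
  · rw [pow_one]
    exact rescale_dualEulerSeries_sq_mul_evenEulerSeries hq2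
  · have hsum := hasSum_div_J_four hq (hasSum_slater_five (neg_ne_zero.2 hq0) (by rwa [norm_neg]))
    have hshift := ((hasSum_nat_add_iff' 1).2 hsum).mul_left (-q)⁻¹
    convert! hshift using 1
    · funext m
      have hne : 1 - (q ^ 4) ^ (m + 1) ≠ 0 := sub_ne_zero.2 (pow_succ_ne_one hq4 m).symm
      rw [neg_pow_sq, qPoch_succ, ← pow_succ', neg_sq, ← pow_mul,
        show 1 + 2 * (m + 1) = 1 + 2 + 2 * m by ring,
        show q ^ (2 * (2 * (m + 1))) = (q ^ 4) ^ (m + 1) by ring]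
      field_simp
      ring
    · rw [sum_range_one, mul_zero, pow_zero, sub_self, mul_zero, zero_mul, sub_zero]
      rw [mul_div_assoc, inv_mul_cancel_left₀ (neg_ne_zero.2 hq0)]

end pairSum

section productForm

theorem J_zero {m : ℕ} (hm : m ≠ 0) : J 0 m = 1 := by
  rw [J, zero_pow hm, qPochInf]
  simp only [zero_mul, sub_zero, tprod_one]

theorem Jtheta_zero {a m : ℕ} (ha : a ≠ 0) (ham : a < m) : Jtheta 0 a m = 1 := by
  rw [Jtheta, zero_pow ha, zero_pow (Nat.sub_pos_of_lt ham).ne', zero_pow (by lia), qPochInf]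
  simp only [zero_mul, sub_zero, tprod_one, mul_one]

theorem Jtheta_ne_zero {q : ℂ} (hq : ‖q‖ < 1) {a m : ℕ} (ha : a ≠ 0) (ham : a < m) :
    Jtheta q a m ≠ 0 := by
  have hqm := norm_pow_lt_one hq (n := m) (by lia)
  exact mul_ne_zero (mul_ne_zero (qPochInf_ne_zero hqm (norm_pow_lt_one hq ha))
    (qPochInf_ne_zero hqm (norm_pow_lt_one hq (by lia)))) (qPochInf_ne_zero hqm hqm)

theorem hasSum_pairTerm_zero {E : ℕ → ℕ → ℕ} (hE : ∀ i j, i + j ≤ E i j) (hE0 : E 0 0 = 0) :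
    HasSum (pairTerm 0 E) 1 := by
  convert! hasSum_single (f := pairTerm 0 E) (0, 0) fun x hx => ?_ using 1
  · simp [pairTerm, hE0, qPoch_zero]
  · have hpos : E x.1 x.2 ≠ 0 := fun h => hx (Prod.ext (by grind) (by grind))
    rw [pairTerm, zero_pow hpos, zero_mul]

theorem quintupleTheta_neg_div_J_four {q : ℂ} (hq0 : q ≠ 0) (hq : ‖q‖ < 1) {a b c : ℕ} (ha : Odd a)
    (ham : a < 7) (hbc : Jtheta q (14 - 2 * a) 28 * (Jtheta q b 28 * Jtheta q c 28) =
      Jtheta q 4 28 * Jtheta q 8 28 * Jtheta q 12 28) :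
    quintupleTheta ((-q) ^ 7) ((-q) ^ a) / J q 4 = J q 14 * J q 28 ^ 2 * Jtheta q (2 * a) 28 /
      (Jtheta q a 28 * Jtheta q b 28 * Jtheta q c 28 * Jtheta q (14 - a) 28) := by
  have hquintuple := quintupleTheta_neg_mul_Jtheta hq0 hq ha ham.le
  have hseven : J q 4 * J q 28 ^ 2 = Jtheta q 4 28 * Jtheta q 8 28 * Jtheta q 12 28 :=
    J_mul_J_seven_mul_sq hq four_ne_zero
  have hJ : J q 4 ≠ 0 :=
    qPochInf_ne_zero (norm_pow_lt_one hq four_ne_zero) (norm_pow_lt_one hq four_ne_zero)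
  have hne (n : ℕ) (hn : n ≠ 0) (hn28 : n < 28) := Jtheta_ne_zero hq hn hn28
  have hbc0 : Jtheta q b 28 * Jtheta q c 28 ≠ 0 := by
    refine right_ne_zero_of_mul (a := Jtheta q (14 - 2 * a) 28) ?_
    rw [hbc]
    exact mul_ne_zero (mul_ne_zero (hne 4 (by lia) (by lia)) (hne 8 (by lia) (by lia)))
      (hne 12 (by lia) (by lia))
  have ha0 := hne a (by grind) (by lia)
  have ha14 := hne (14 - a) (by lia) (by lia)
  rw [div_eq_div_iff hJ (by
    rw [mul_assoc (Jtheta q a 28)]; exact mul_ne_zero (mul_ne_zero ha0 hbc0) ha14)]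
  linear_combination Jtheta q b 28 * Jtheta q c 28 * hquintuple +
    J q 14 * Jtheta q (2 * a) 28 * (hbc - hseven)

theorem hasSum_pairTerm_of_quintupleTheta {q : ℂ} (hq : ‖q‖ < 1) {γ δ a b c : ℕ} (ha : Odd a)
    (ham : a < 7) (hb : b ≠ 0) (hb28 : b < 28) (hc : c ≠ 0) (hc28 : c < 28)
    (hbc : Jtheta q (14 - 2 * a) 28 * (Jtheta q b 28 * Jtheta q c 28) =
      Jtheta q 4 28 * Jtheta q 8 28 * Jtheta q 12 28)
    (h : q ≠ 0 → HasSum (pairTerm q (pairExponent γ δ))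
      (quintupleTheta ((-q) ^ 7) ((-q) ^ a) / J q 4)) :
    HasSum (pairTerm q (pairExponent γ δ)) (J q 14 * J q 28 ^ 2 * Jtheta q (2 * a) 28 /
      (Jtheta q a 28 * Jtheta q b 28 * Jtheta q c 28 * Jtheta q (14 - a) 28)) := by
  rcases eq_or_ne q 0 with rfl | hq0
  · convert! hasSum_pairTerm_zero (add_le_pairExponent γ δ) rfl using 1
    rw [J_zero (by lia), J_zero (by lia), Jtheta_zero (by grind) (by lia),
      Jtheta_zero (by grind) (by lia), Jtheta_zero hb hb28, Jtheta_zero hc hc28,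
      Jtheta_zero (by lia) (by lia)]
    norm_num
  · rw [← quintupleTheta_neg_div_J_four hq0 hq ha ham hbc]
    exact h hq0

theorem hasSum_pairTerm_Jtheta_one {q : ℂ} (hq : ‖q‖ < 1) :
    HasSum (pairTerm q (pairExponent 0 0)) (J q 14 * J q 28 ^ 2 * Jtheta q 2 28 /
      (Jtheta q 1 28 * Jtheta q 4 28 * Jtheta q 8 28 * Jtheta q 13 28)) :=
  hasSum_pairTerm_of_quintupleTheta hq (a := 1) (b := 4) (c := 8) (by decide) (by lia) (by lia)
    (by lia) (by lia) (by lia) (by ring) fun hq0 => hasSum_pairTerm_quintupleTheta_one hq0 hq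

theorem hasSum_pairTerm_Jtheta_three {q : ℂ} (hq : ‖q‖ < 1) :
    HasSum (pairTerm q (pairExponent 0 1)) (J q 14 * J q 28 ^ 2 * Jtheta q 6 28 /
      (Jtheta q 3 28 * Jtheta q 4 28 * Jtheta q 11 28 * Jtheta q 12 28)) := by
  rw [mul_right_comm _ (Jtheta q 11 28)]
  exact hasSum_pairTerm_of_quintupleTheta hq (a := 3) (b := 4) (c := 12) (by decide) (by lia)
    (by lia) (by lia) (by lia) (by lia) (by ring)
    fun hq0 => hasSum_pairTerm_quintupleTheta_three hq0 hq

theorem hasSum_pairTerm_Jtheta_five {q : ℂ} (hq : ‖q‖ < 1) :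
    HasSum (pairTerm q (pairExponent 2 1)) (J q 14 * J q 28 ^ 2 * Jtheta q 10 28 /
      (Jtheta q 5 28 * Jtheta q 8 28 * Jtheta q 9 28 * Jtheta q 12 28)) := by
  rw [mul_right_comm _ (Jtheta q 9 28)]
  exact hasSum_pairTerm_of_quintupleTheta hq (a := 5) (b := 8) (c := 12) (by decide) (by lia)
    (by lia) (by lia) (by lia) (by lia) (by ring)
    fun hq0 => hasSum_pairTerm_quintupleTheta_five hq0 hq

end productForm

section tripleSum

variable {q S T : ℂ} {E : ℕ → ℕ → ℕ} {Q : ℤ → ℤ → ℤ → ℤ}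

theorem nahmTerm_eq (r : ℕ) {N : ℕ → ℕ → ℕ → ℕ} (hQ : ∀ i j k : ℕ, Q i j k = N i j k)
    (i j k : ℕ) : nahmTerm q r Q (i, j, k) = q ^ N i j k * ((qPoch (q ^ r) (q ^ r) i)⁻¹ *
      ((qPoch (q ^ r) (q ^ r) j)⁻¹ * (qPoch (q ^ (2 * r)) (q ^ (2 * r)) k)⁻¹)) := by
  simp only [nahmTerm, hQ, zpow_natCast]
  ring

theorem summable_nahmTerm (hq : ‖q‖ < 1) {r : ℕ} (hr : r ≠ 0) {N : ℕ → ℕ → ℕ → ℕ}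
    (hQ : ∀ i j k : ℕ, Q i j k = N i j k) (hN : ∀ i j k, i + j + k ≤ N i j k) :
    Summable (nahmTerm q r Q) := by
  have hqr := norm_pow_lt_one hq hr
  have hq2r := norm_pow_lt_one hq (n := 2 * r) (by lia)
  have hgeom := summable_geometric_of_lt_one (norm_nonneg q) hq
  have hgeom_nonneg : (0 : ℕ → ℝ) ≤ fun n => ‖q‖ ^ n := fun _ => by positivity
  obtain ⟨C, hC⟩ := exists_norm_inv_qPoch_le hqr hqr
  obtain ⟨D, hD⟩ := exists_norm_inv_qPoch_le hq2r hq2r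
  have hbound (x : ℕ × ℕ) : ‖(qPoch (q ^ r) (q ^ r) x.1)⁻¹ *
      (qPoch (q ^ (2 * r)) (q ^ (2 * r)) x.2)⁻¹‖ ≤ C * D := by
    rw [norm_mul]
    exact mul_le_mul (hC _) (hD _) (norm_nonneg _) ((norm_nonneg _).trans (hC 0))
  have hsum := summable_mul_mul_of_norm_le (w := fun x => q ^ N x.1 x.2.1 x.2.2) hgeom
    (hgeom.mul_of_nonneg hgeom hgeom_nonneg hgeom_nonneg) hgeom_nonneg
    (fun _ => by positivity) (fun x => ?_) ⟨C, hC⟩ ⟨C * D, hbound⟩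
  · exact hsum.congr fun x => (nahmTerm_eq r hQ x.1 x.2.1 x.2.2).symm
  · rw [← pow_add, ← pow_add, ← add_assoc]
    exact norm_pow_le_pow hq (hN _ _ _)

open PowerSeries in
theorem hasSum_nahmTerm_four (hq : ‖q‖ < 1) (hE : ∀ i j, i + j ≤ E i j)
    (h : HasSum (pairTerm q E) S)
    (hQ : ∀ i j k : ℕ, Q i j k = (E i (j + 2 * k) + 4 * j.choose 2 : ℕ)) :
    HasSum (nahmTerm q 4 Q) S := by
  have hq4 := norm_pow_lt_one hq four_ne_zero
  have hsum : Summable (nahmTerm q 4 Q) := summable_nahmTerm hq four_ne_zero hQ fun i j k => by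
    have := hE i (j + 2 * k)
    lia
  refine hasSum_prod_of_fiberwise hsum (fun i => ?_) (h.prod_fiberwise fun i =>
    (h.summable.prod_factor i).hasSum)
  let W (n : ℕ) : ℂ := q ^ E i n * (qPoch (q ^ 4) (q ^ 4) i)⁻¹
  have hterm (x : ℕ × ℕ) : nahmTerm q 4 Q (i, x) = W (x.1 + 2 * x.2) *
      (coeff x.1 (dualEulerSeries (q ^ 4)) * coeff x.2 (eulerSeries ((q ^ 4) ^ 2))) := by
    rw [nahmTerm_eq 4 hQ, dualEulerSeries, eulerSeries, coeff_mk, coeff_mk, ← pow_mul' q 2 4]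
    simp only [W]
    ring
  have hpair : HasSum (fun n => W n * coeff n (dualEulerSeries (q ^ 4) * evenEulerSeries (q ^ 4)))
      (∑' n, pairTerm q E (i, n)) := by
    rw [dualEulerSeries_mul_evenEulerSeries hq4]
    refine (h.summable.prod_factor i).hasSum.congr_fun fun n => ?_
    rw [eulerSeries, coeff_mk, pairTerm]
    ring
  exact (hasSum_mul_coeff_of_hasSum_mul_expand two_ne_zero ((hsum.prod_factor i).congr hterm)
    hpair).congr_fun hterm

theorem qPochInf_neg_pow_mul_inv_qPoch (hq : ‖q‖ < 1) (j : ℕ) :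
    qPochInf (-q ^ (2 + 2 * j)) (q ^ 2) * (qPoch (q ^ 2) (q ^ 2) j)⁻¹ =
      J q 4 / J q 2 * (qPoch (q ^ 4) (q ^ 4) j)⁻¹ := by
  have hq2 := norm_pow_lt_one hq two_ne_zero
  have hpos := qPoch_ne_zero hq2 hq2.le j
  have hneg := qPoch_ne_zero (a := -q ^ 2) (by rwa [norm_neg]) hq2.le j
  have htwo : J q 2 ≠ 0 := qPochInf_ne_zero hq2 hq2
  have hfour : J q 4 = J q 2 * qPochInf (-q ^ 2) (q ^ 2) := by
    rw [J, J, ← qPochInf_sq hq2, ← pow_mul]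
  have hsq : qPoch (q ^ 4) (q ^ 4) j = qPoch (q ^ 2) (q ^ 2) j * qPoch (-q ^ 2) (q ^ 2) j := by
    rw [← qPoch_sq, ← pow_mul]
  rw [hfour, hsq, qPochInf_eq_mul hq2 (-q ^ 2) j,
    show -q ^ 2 * (q ^ 2) ^ j = -q ^ (2 + 2 * j) by ring]
  field_simp

theorem hasSum_nahmTerm_two (hq : ‖q‖ < 1) (hE : ∀ i j, i + j ≤ E i j)
    (h : HasSum (pairTerm q E) S)
    (hQ : ∀ i j k : ℕ, Q i j k = (i ^ 2 + i + 2 * i * j + E j k : ℕ))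
    (hT : T = J q 4 / J q 2 * S) :
    HasSum (nahmTerm q 2 Q) T := by
  subst hT
  have hq2 := norm_pow_lt_one hq two_ne_zero
  have hsum : Summable (nahmTerm q 2 Q) := summable_nahmTerm hq two_ne_zero hQ fun i j k => by
    have := hE j k
    lia
  refine (Equiv.prodComm (ℕ × ℕ) ℕ).hasSum_iff.1 (hasSum_prod_of_fiberwise
    ((Equiv.prodComm (ℕ × ℕ) ℕ).summable_iff.2 hsum) (fun x => ?_) (h.mul_left (J q 4 / J q 2)))
  have heuler := (hasSum_euler hq2 (-q ^ (2 + 2 * x.1))).mul_right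
    (q ^ E x.1 x.2 * ((qPoch (q ^ 2) (q ^ 2) x.1)⁻¹ * (qPoch (q ^ 4) (q ^ 4) x.2)⁻¹))
  convert! heuler using 1
  · funext i
    rw [Function.comp_apply, Equiv.prodComm_apply, Prod.swap_prod_mk, nahmTerm_eq 2 hQ, neg_neg]
    have hexp : i ^ 2 + i + 2 * i * x.1 + E x.1 x.2 =
        2 * i.choose 2 + (2 + 2 * x.1) * i + E x.1 x.2 := by
      linear_combination -two_mul_choose_two_add i
    rw [hexp]
    ring
  · rw [pairTerm]
    linear_combination -(q ^ E x.1 x.2 * (qPoch (q ^ 4) (q ^ 4) x.2)⁻¹) *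
      qPochInf_neg_pow_mul_inv_qPoch hq x.1

theorem four_mul_choose_two (n : ℕ) : (4 * n.choose 2 : ℤ) = 2 * n ^ 2 - 2 * n := by
  have h : (2 * n.choose 2 + n : ℤ) = n ^ 2 := mod_cast two_mul_choose_two_add n
  linear_combination 2 * h

theorem natCast_pairExponent (γ δ i j : ℕ) : (pairExponent γ δ i j : ℤ) =
    3 * i ^ 2 + 4 * i * j + 4 * j ^ 2 + (γ + 2 * δ - 2) * i + 2 * γ * j := by
  rw [pairExponent]
  push_cast
  linear_combination four_mul_choose_two i

end tripleSum

theorem mainTheorem10 (q : ℂ) (hq : ‖q‖ < 1) :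
    (HasSum (nahmTerm q 2 fun i j k => i^2 + 3*j^2 + 4*k^2 + 2*i*j + 4*j*k + i - 2*j)
        (J q 4 * J q 14 * J q 28 ^ 2 * Jtheta q 2 28 /
          (J q 2 * Jtheta q 1 28 * Jtheta q 4 28 * Jtheta q 8 28 * Jtheta q 13 28)) ∧
      HasSum (nahmTerm q 2 fun i j k => i^2 + 3*j^2 + 4*k^2 + 2*i*j + 4*j*k + i)
        (J q 4 * J q 14 * J q 28 ^ 2 * Jtheta q 6 28 /
          (J q 2 * Jtheta q 3 28 * Jtheta q 4 28 * Jtheta q 11 28 * Jtheta q 12 28)) ∧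
      HasSum (nahmTerm q 2 fun i j k => i^2 + 3*j^2 + 4*k^2 + 2*i*j + 4*j*k + i + 2*j + 4*k)
        (J q 4 * J q 14 * J q 28 ^ 2 * Jtheta q 10 28 /
          (J q 2 * Jtheta q 5 28 * Jtheta q 8 28 * Jtheta q 9 28 * Jtheta q 12 28))) ∧
    (HasSum (nahmTerm q 2 fun i j k => i^2 + 4*j^2 + 3*k^2 + 2*i*j + 4*j*k + i - 2*k)
        (J q 4 * J q 14 * J q 28 ^ 2 * Jtheta q 2 28 /
          (J q 2 * Jtheta q 1 28 * Jtheta q 4 28 * Jtheta q 8 28 * Jtheta q 13 28)) ∧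
      HasSum (nahmTerm q 2 fun i j k => i^2 + 4*j^2 + 3*k^2 + 2*i*j + 4*j*k + i)
        (J q 4 * J q 14 * J q 28 ^ 2 * Jtheta q 6 28 /
          (J q 2 * Jtheta q 3 28 * Jtheta q 4 28 * Jtheta q 11 28 * Jtheta q 12 28)) ∧
      HasSum (nahmTerm q 2 fun i j k => i^2 + 4*j^2 + 3*k^2 + 2*i*j + 4*j*k + i + 4*j + 2*k)
        (J q 4 * J q 14 * J q 28 ^ 2 * Jtheta q 10 28 /
          (J q 2 * Jtheta q 5 28 * Jtheta q 8 28 * Jtheta q 9 28 * Jtheta q 12 28))) ∧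
    (HasSum (nahmTerm q 4 fun i j k => 3*i^2 + 6*j^2 + 16*k^2 + 4*i*j + 8*i*k + 16*j*k - 2*i - 2*j)
        (J q 14 * J q 28 ^ 2 * Jtheta q 2 28 /
          (Jtheta q 1 28 * Jtheta q 4 28 * Jtheta q 8 28 * Jtheta q 13 28)) ∧
      HasSum (nahmTerm q 4 fun i j k => 3*i^2 + 6*j^2 + 16*k^2 + 4*i*j + 8*i*k + 16*j*k - 2*j)
        (J q 14 * J q 28 ^ 2 * Jtheta q 6 28 /
          (Jtheta q 3 28 * Jtheta q 4 28 * Jtheta q 11 28 * Jtheta q 12 28)) ∧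
      HasSum (nahmTerm q 4 fun i j k => 3*i^2 + 6*j^2 + 16*k^2 + 4*i*j + 8*i*k + 16*j*k + 2*i + 2*j + 8*k)
        (J q 14 * J q 28 ^ 2 * Jtheta q 10 28 /
          (Jtheta q 5 28 * Jtheta q 8 28 * Jtheta q 9 28 * Jtheta q 12 28))) ∧
    (HasSum (nahmTerm q 4 fun i j k => 4*i^2 + 5*j^2 + 12*k^2 + 4*i*j + 8*i*k + 12*j*k - 4*j - 4*k)
        (J q 14 * J q 28 ^ 2 * Jtheta q 2 28 /
          (Jtheta q 1 28 * Jtheta q 4 28 * Jtheta q 8 28 * Jtheta q 13 28)) ∧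
      HasSum (nahmTerm q 4 fun i j k => 4*i^2 + 5*j^2 + 12*k^2 + 4*i*j + 8*i*k + 12*j*k - 2*j)
        (J q 14 * J q 28 ^ 2 * Jtheta q 6 28 /
          (Jtheta q 3 28 * Jtheta q 4 28 * Jtheta q 11 28 * Jtheta q 12 28)) ∧
      HasSum (nahmTerm q 4 fun i j k => 4*i^2 + 5*j^2 + 12*k^2 + 4*i*j + 8*i*k + 12*j*k + 4*i + 4*k)
        (J q 14 * J q 28 ^ 2 * Jtheta q 10 28 /
          (Jtheta q 5 28 * Jtheta q 8 28 * Jtheta q 9 28 * Jtheta q 12 28))) := by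
  have hE := add_le_pairExponent
  have hE' (γ δ i j : ℕ) : i + j ≤ pairExponent γ δ j i := add_comm i j ▸ hE γ δ j i
  have h₁ := hasSum_pairTerm_Jtheta_one hq
  have h₃ := hasSum_pairTerm_Jtheta_three hq
  have h₅ := hasSum_pairTerm_Jtheta_five hq
  have h₁' := hasSum_pairTerm_swap h₁
  have h₃' := hasSum_pairTerm_swap h₃
  have h₅' := hasSum_pairTerm_swap h₅
  refine ⟨⟨hasSum_nahmTerm_two hq (hE 0 0) h₁ ?_ (by ring),
      hasSum_nahmTerm_two hq (hE 0 1) h₃ ?_ (by ring),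
      hasSum_nahmTerm_two hq (hE 2 1) h₅ ?_ (by ring)⟩,
    ⟨hasSum_nahmTerm_two hq (hE' 0 0) h₁' ?_ (by ring),
      hasSum_nahmTerm_two hq (hE' 0 1) h₃' ?_ (by ring),
      hasSum_nahmTerm_two hq (hE' 2 1) h₅' ?_ (by ring)⟩,
    ⟨hasSum_nahmTerm_four hq (hE 0 0) h₁ ?_, hasSum_nahmTerm_four hq (hE 0 1) h₃ ?_,
      hasSum_nahmTerm_four hq (hE 2 1) h₅ ?_⟩,
    ⟨hasSum_nahmTerm_four hq (hE' 0 0) h₁' ?_, hasSum_nahmTerm_four hq (hE' 0 1) h₃' ?_,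
      hasSum_nahmTerm_four hq (hE' 2 1) h₅' ?_⟩⟩
  all_goals
    intro i j k
    push_cast [natCast_pairExponent, four_mul_choose_two]
    ring
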